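/- Let $n\ge 2$ be even and let $\ell_1,\dots,\ell_n$ be prime numbers such that - $\ell_1\equiv 3 \pmod 8$ and $\ell_i\equiv 5\pmod 8$ for $2\le i\le n$; - $\left(\frac{\ell_1}{\ell_2}\right)=-1$, $\left(\frac{\ell_1}{\ell_j}\right)=1$ for $3\le j\le n$, and $\left(\frac{\ell_i}{\ell_j}\right)=-1$ for $2\le i<j\le n$. Put $m=\ell_1\ell_2\cdots\ell_n$ and $K=\mathbb{Q}(\sqrt m)$. For a number field $K$ and a prime $p$, let $\mathcal U_{K,p}=\prod_{v\mid p}(1+\mathfrak m_v)$ be the group of principal local units at $p$, let $\mathcal E_{K,p}$ be the closure in $\mathcal U_{K,p}$ of the group of those global units of $K$ that are principal at every $v\mid p$, let $\log_p$ be the $p$-adic logarithm on $\mathcal U_{K,p}$ (with values in $\prod_{v\mid p}K_v$), and let $$\mathcal R_{K,p}=\mathrm{tor}_{\mathbb Z_p}\bigl(\log_p(\mathcal U_{K,p})/\log_p(\mathcal E_{K,p})\bigr)$$ be the normalized $p$-adic regulator. Then $\mathcal R_{K,2}$ is trivial. Moreover, every fundamental unit $\varepsilon$ of $K$ (a unit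 which together with $-1$ generates the group of units of the ring of integers) has the form $\varepsilon=4a'+b\sqrt m$ with $a',b$ odd integers, and $\log_2(\varepsilon)\sim 4$, i.e. $\log_2(\varepsilon)$ and $4$ have the same valuation at each place of $K$ above $2$. -/

import Mathlib

open NumberField IsDedekindDomain

/-- The places of `K` above the prime number `p`: the nonzero primes of `𝓞 K` containing `p`. -/
abbrev PlacesAbove (K : Type*) [Field K] [NumberField K] (p : ℕ) : Type _ :=
  {v : HeightOneSpectrum (𝓞 K) // (p : 𝓞 K) ∈ v.asIdeal}

/-- The product `∏_{v ∣ p} K_v` of the completions of `K` at the places above `p`,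
with the product topology. -/
abbrev CompletionsAbove (K : Type*) [Field K] [NumberField K] (p : ℕ) : Type _ :=
  (v : PlacesAbove K p) → v.1.adicCompletion K

/-- The group `𝒰_{K,p} = ∏_{v ∣ p} (1 + 𝔪_v)` of principal local units at `p`. -/
def principalLocalUnits (K : Type*) [Field K] [NumberField K] (p : ℕ) :
    Subgroup (CompletionsAbove K p)ˣ where
  carrier := {u | ∀ v, Valued.v ((u : CompletionsAbove K p) v - 1) < 1}
  one_mem' := by
    intro v
    simp
  mul_mem' := by
    intro a b ha hb v
    have h1 := ha v
    have h2 := hb v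
    have h3 : Valued.v ((b : CompletionsAbove K p) v) = 1 := by
      have := Valuation.map_one_add_of_lt (v := Valued.v) h2
      simpa using this
    have e : ((a * b : (CompletionsAbove K p)ˣ) : CompletionsAbove K p) v - 1 =
        ((a : CompletionsAbove K p) v - 1) * (b : CompletionsAbove K p) v +
          ((b : CompletionsAbove K p) v - 1) := by
      simp only [Units.val_mul, Pi.mul_apply]
      ring
    rw [e]
    refine Valuation.map_add_lt _ ?_ h2
    rw [map_mul, h3, mul_one]
    exact h1
  inv_mem' := by
    intro a ha v
    have h1 := ha v
    have h3 : Valued.v ((a : CompletionsAbove K p) v) = 1 := by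
      have := Valuation.map_one_add_of_lt (v := Valued.v) h1
      simpa using this
    have h4 : (a : CompletionsAbove K p) v * ((a⁻¹ : (CompletionsAbove K p)ˣ) :
        CompletionsAbove K p) v = 1 := by
      rw [← Pi.mul_apply, Units.mul_inv, Pi.one_apply]
    have e : Valued.v (((a⁻¹ : (CompletionsAbove K p)ˣ) : CompletionsAbove K p) v - 1) =
        Valued.v ((a : CompletionsAbove K p) v - 1) := by
      have h5 : Valued.v ((a : CompletionsAbove K p) v *
          (((a⁻¹ : (CompletionsAbove K p)ˣ) : CompletionsAbove K p) v - 1)) =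
          Valued.v ((a : CompletionsAbove K p) v - 1) := by
        rw [mul_sub, h4, mul_one, Valuation.map_sub_swap]
      rwa [map_mul, h3, one_mul] at h5
    rw [e]
    exact h1

/-- The diagonal embedding `E_K → (∏_{v ∣ p} K_v)ˣ` of the group `E_K` of units of `𝓞 K`. -/
noncomputable def unitsDiagonal (K : Type*) [Field K] [NumberField K] (p : ℕ) :
    (𝓞 K)ˣ →* (CompletionsAbove K p)ˣ :=
  Units.map (((algebraMap K (CompletionsAbove K p)).comp (algebraMap (𝓞 K) K)).toMonoidHom)

/-- The group `ℰ_{K,p}`: the closure in `𝒰_{K,p}` of the (diagonally embedded) global units of `K`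
that are principal at every place above `p`. (As `𝒰_{K,p}` is closed in `(∏_{v ∣ p} K_v)ˣ`, the
closure may be taken there; every global unit has a power of exponent prime to `p` that is
principal at `p`.) -/
noncomputable def closureOfUnits (K : Type*) [Field K] [NumberField K] (p : ℕ) :
    Subgroup (CompletionsAbove K p)ˣ :=
  ((unitsDiagonal K p).range ⊓ principalLocalUnits K p).topologicalClosure

/-- The `p`-adic logarithm on principal units, place by place:
`log_p(1 + x) = ∑_{k ≥ 1} (-1)^(k-1) x^k / k`. -/
noncomputable def localLog (K : Type*) [Field K] [NumberField K] (p : ℕ)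
    (u : (CompletionsAbove K p)ˣ) : CompletionsAbove K p :=
  fun v => ∑' k : ℕ, (-1) ^ k * ((u : CompletionsAbove K p) v - 1) ^ (k + 1) / ((k : ℕ) + 1)

/-- `log_p(A)` for a group `A` of principal units: the subgroup generated by the values
`log_p(a)`, `a ∈ A`. (These values already form a group, `log_p` being a homomorphism.) -/
noncomputable def logImage (K : Type*) [Field K] [NumberField K] (p : ℕ)
    (A : Subgroup (CompletionsAbove K p)ˣ) : AddSubgroup (CompletionsAbove K p) :=
  AddSubgroup.closure (localLog K p '' (A : Set (CompletionsAbove K p)ˣ))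

/-- The normalized `p`-adic regulator
`ℛ_{K,p} = tor_{ℤ_p} (log_p(𝒰_{K,p}) / log_p(ℰ_{K,p}))`.
(In a `ℤ_p`-module, being killed by a nonzero element of `ℤ_p` is the same as having finite
additive order, so the `ℤ_p`-torsion is the torsion of the underlying abelian group.) -/
noncomputable abbrev NormalizedRegulator (K : Type*) [Field K] [NumberField K] (p : ℕ) : Type _ :=
  AddCommGroup.torsion
    (logImage K p (principalLocalUnits K p) ⧸
      (logImage K p (closureOfUnits K p)).addSubgroupOf (logImage K p (principalLocalUnits K p)))

/-- The Deng-Li conditions on prime numbers `ℓ 1, …, ℓ n`, `n` even. All the lower entries of the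
symbols `jacobiSym` below are odd primes, so these are Legendre symbols. -/
structure IsDengLi (n : ℕ) (ℓ : ℕ → ℕ) : Prop where
  two_le : 2 ≤ n
  even : Even n
  prime : ∀ i, 1 ≤ i → i ≤ n → (ℓ i).Prime
  first_mod : ℓ 1 % 8 = 3
  other_mod : ∀ i, 2 ≤ i → i ≤ n → ℓ i % 8 = 5
  first_second : jacobiSym (ℓ 1) (ℓ 2) = -1
  first_other : ∀ j, 3 ≤ j → j ≤ n → jacobiSym (ℓ 1) (ℓ j) = 1
  other_other : ∀ i j, 2 ≤ i → i < j → j ≤ n → jacobiSym (ℓ i) (ℓ j) = -1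

/-!
Write `m = ℓ₁ ⋯ ℓₙ`, so that `m ≡ 7 mod 8` and `𝓞 K = ℤ[√m]`. The argument has a global and a
local half.

*Global half.* As `-1` is not a norm, the units of `𝓞 K` are the solutions of the Pell equation
`x² - m y² = 1`. Factoring `x² - 1 = m y²` gives `d₁ d₂ = m` with `d₂ s² - d₁ r² = 1` if `x` is odd,
and `d₂ s² - d₁ r² = 2` if `x` is even. The prescribed Legendre symbols, evaluated at the `ℓᵢ`,
leave only `d₂ = 1` in the first case (`IsDengLi.sdiff_eq_empty`, `IsDengLi.not_first_dvd_right`),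
so that `x + y√m = ±(s + r√m)²` is not fundamental. In the second case they force
`d₁ ≡ 3 mod 8` (`IsDengLi.even_card`), so that `x = d₁ r² + 1 ≡ 4 mod 8`. Hence a fundamental unit
is `ε = 4a + b√m` with `a`, `b` odd (`IsDengLi.exists_fundamentalUnit_eq`).

*Local half.* The prime `2` is ramified, with uniformizer `1 + √m` and residue field `𝔽₂`.
Valuations below are normalized by `v(1 + √m) = 1`, and `log` is the `2`-adic logarithm. It is the
limit of `(u ^ (2 ^ n) - 1) / 2 ^ n` (`tendsto_seriesLog`), hence a homomorphism, and it is
isometric on units congruent to `1` modulo the cube of the maximal ideal (`map_seriesLog`). Up to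
multiplication by `-1` and `√m`, with logarithms zero and small, every principal unit is of this
form, so `v(log u) ≥ 3` for all principal units `u` (`map_seriesLog_le`). On the other hand
`-ε² = 1 - 8aε` gives `v(log ε) = 4` (`map_seriesLog_eq`), the valuation of `4`. Finally, if a nonzero
multiple of `z = log u` lies in `ℤ₂ log ε`, then `z = c log ε` with `c ∈ ℚ₂` and `v(c) ≥ -1`; as
`v(2) = 2`, this means `c ∈ ℤ₂`. So `ℤ₂ log ε`, the logarithmic image of the closure of the units,
is saturated in that of the principal units (`approx_of_natCast_mul`,
`subsingleton_normalizedRegulator`), and the quotient has no torsion.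
-/

/-! ### Legendre symbols and factorizations -/

section Symbols

open scoped NumberTheorySymbols

/-- `d r² ≡ c mod p` with `p ∤ c` determines the symbol of `d`. -/
theorem jacobiSym_eq_of_dvd_mul_sq_sub {p : ℕ} {d r c : ℤ}
    (h : (p : ℤ) ∣ d * r ^ 2 - c) (hc : J(c | p) ≠ 0) : J(d | p) = J(c | p) := by
  have e : J(c | p) = J(d | p) * J(r | p) ^ 2 := by
    rw [← jacobiSym.pow_left, ← jacobiSym.mul_left]
    exact jacobiSym.mod_left' (Int.modEq_iff_dvd.2 h)
  rcases jacobiSym.trichotomy r p with h0 | h0 | h0 <;> simp_all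

theorem jacobiSym_prod_left {ι : Type*} (s : Finset ι) (f : ι → ℤ) (p : ℕ) :
    J(∏ i ∈ s, f i | p) = ∏ i ∈ s, J(f i | p) := by
  classical
  induction s using Finset.induction_on with
  | empty => simp
  | insert a s ha ih => rw [Finset.prod_insert ha, Finset.prod_insert ha, jacobiSym.mul_left, ih]

/-- A factorization `A * B = (∏ ℓ i) * y ^ 2` into coprime factors distributes the primes `ℓ i`
between the two factors, up to squares. -/
theorem exists_eq_prod_mul_sq_of_coprime {ι : Type*} [DecidableEq ι] (I : Finset ι) (ℓ : ι → ℕ)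
    (hp : ∀ i ∈ I, (ℓ i).Prime) (hinj : Set.InjOn ℓ I) {A B y : ℕ}
    (hAB : A.Coprime B) (h : A * B = (∏ i ∈ I, ℓ i) * y ^ 2) :
    ∃ T ⊆ I, ∃ r s : ℕ, A = (∏ i ∈ T, ℓ i) * r ^ 2 ∧ B = (∏ i ∈ I \ T, ℓ i) * s ^ 2 ∧
      y = r * s := by
  have key : ∀ T ⊆ I, ∀ C, (∀ i ∈ T, ℓ i ∣ C) → ∏ i ∈ T, ℓ i ∣ C := by
    intro T hT C hC
    refine Finset.prod_dvd_of_isRelPrime (fun i hi j hj hij => ?_) hC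
    exact Nat.coprime_iff_isRelPrime.1 ((Nat.coprime_primes (hp i (hT hi)) (hp j (hT hj))).2
      fun e => hij (hinj (hT hi) (hT hj) e))
  have hT : I.filter (fun i => ℓ i ∣ A) ⊆ I := Finset.filter_subset _ _
  obtain ⟨A', hA'⟩ := key (I.filter fun i => ℓ i ∣ A) hT A
    fun i hi => (Finset.mem_filter.1 hi).2
  obtain ⟨B', hB'⟩ := key (I \ I.filter fun i => ℓ i ∣ A) Finset.sdiff_subset B (by
    intro i hi
    obtain ⟨hiI, hiA⟩ := Finset.mem_sdiff.1 hi
    have : ℓ i ∣ A * B := h ▸ (Finset.dvd_prod_of_mem ℓ hiI).mul_right _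
    refine ((hp i hiI).dvd_mul.1 this).resolve_left fun hd => hiA ?_
    exact Finset.mem_filter.2 ⟨hiI, hd⟩)
  have hcop : IsUnit (gcd A' B') := by
    rw [Nat.isUnit_iff]
    rw [hA', hB'] at hAB
    exact Nat.Coprime.coprime_mul_left (Nat.Coprime.coprime_mul_left_right hAB)
  have hy : A' * B' = y ^ 2 := by
    have hpos : 0 < ∏ i ∈ I, ℓ i := Finset.prod_pos fun i hi => (hp i hi).pos
    refine Nat.eq_of_mul_eq_mul_left hpos ?_
    rw [← h]
    conv_rhs => rw [hA', hB']
    rw [← Finset.prod_sdiff hT]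
    ring
  obtain ⟨r, hr⟩ := exists_eq_pow_of_mul_eq_pow hcop hy
  obtain ⟨s, hs⟩ := exists_eq_pow_of_mul_eq_pow (by rwa [gcd_comm] at hcop) (mul_comm A' B' ▸ hy)
  refine ⟨_, hT, r, s, hr ▸ hA', hs ▸ hB', ?_⟩
  rw [hr, hs, ← mul_pow] at hy
  exact (Nat.pow_left_injective two_ne_zero hy).symm

namespace IsDengLi

variable {n : ℕ} {ℓ : ℕ → ℕ}

theorem prime_of_mem (hℓ : IsDengLi n ℓ) {i : ℕ} (hi : i ∈ Finset.Icc 2 n) : (ℓ i).Prime :=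
  hℓ.prime i (by grind) (by grind)

theorem mod_eight_of_mem (hℓ : IsDengLi n ℓ) {i : ℕ} (hi : i ∈ Finset.Icc 2 n) : ℓ i % 8 = 5 :=
  hℓ.other_mod i (by grind) (by grind)

theorem prod_mod_eight (hℓ : IsDengLi n ℓ) {T : Finset ℕ} (hT : T ⊆ Finset.Icc 2 n) :
    (∏ i ∈ T, ℓ i) % 8 = if Even T.card then 1 else 5 := by
  have : (∏ i ∈ T, ℓ i) % 8 = 5 ^ T.card % 8 := by
    rw [Finset.prod_nat_mod, Finset.prod_congr rfl fun i hi => hℓ.mod_eight_of_mem (hT hi)]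
    simp
  rw [this]
  split_ifs with h
  · obtain ⟨k, hk⟩ := h
    rw [hk, ← two_mul, pow_mul, Nat.pow_mod]
    simp
  · obtain ⟨k, hk⟩ := Nat.not_even_iff_odd.1 h
    rw [hk, pow_succ, pow_mul, Nat.mul_mod, Nat.pow_mod]
    simp

theorem odd_card (hℓ : IsDengLi n ℓ) : Odd (Finset.Icc 2 n).card := by
  have := hℓ.two_le
  have h2 := hℓ.even
  simp only [Nat.card_Icc]
  grind

theorem Icc_eq (hℓ : IsDengLi n ℓ) : Finset.Icc 1 n = insert 1 (Finset.Icc 2 n) := by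
  have := hℓ.two_le
  grind

theorem prod_eq (hℓ : IsDengLi n ℓ) :
    ∏ i ∈ Finset.Icc 1 n, ℓ i = ℓ 1 * ∏ i ∈ Finset.Icc 2 n, ℓ i := by
  rw [hℓ.Icc_eq, Finset.prod_insert (by simp)]

theorem prod_Icc_mod_eight (hℓ : IsDengLi n ℓ) : (∏ i ∈ Finset.Icc 1 n, ℓ i) % 8 = 7 := by
  have h := hℓ.prod_mod_eight subset_rfl
  rw [if_neg (Nat.not_even_iff_odd.2 hℓ.odd_card)] at h
  rw [hℓ.prod_eq, Nat.mul_mod, hℓ.first_mod, h]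

theorem jacobiSym_neg_one (hℓ : IsDengLi n ℓ) {i : ℕ} (hi : i ∈ Finset.Icc 2 n) :
    J(-1 | ℓ i) = 1 := by
  have := hℓ.mod_eight_of_mem hi
  rw [jacobiSym.at_neg_one (by grind), ZMod.χ₄_nat_one_mod_four (by omega)]

theorem jacobiSym_two (hℓ : IsDengLi n ℓ) {i : ℕ} (hi : i ∈ Finset.Icc 2 n) :
    J(2 | ℓ i) = -1 := by
  have := hℓ.mod_eight_of_mem hi
  rw [jacobiSym.at_two (by grind), ZMod.χ₈_nat_eq_if_mod_eight]
  grind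

theorem jacobiSym_first_of_ne (hℓ : IsDengLi n ℓ) {i : ℕ} (hi : i ∈ Finset.Icc 2 n)
    (h2 : i ≠ 2) : J(ℓ 1 | ℓ i) = 1 :=
  hℓ.first_other i (by grind) (by grind)

theorem jacobiSym_comm (hℓ : IsDengLi n ℓ) {i : ℕ} (hi : i ∈ Finset.Icc 2 n) :
    J(ℓ i | ℓ 1) = J(ℓ 1 | ℓ i) := by
  have := hℓ.mod_eight_of_mem hi
  have := hℓ.first_mod
  exact jacobiSym.quadratic_reciprocity_one_mod_four (by omega) (by grind)

theorem jacobiSym_of_ne (hℓ : IsDengLi n ℓ) {i j : ℕ} (hi : i ∈ Finset.Icc 2 n)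
    (hj : j ∈ Finset.Icc 2 n) (hij : i ≠ j) : J(ℓ i | ℓ j) = -1 := by
  have h1 := hℓ.mod_eight_of_mem hi
  have h2 := hℓ.mod_eight_of_mem hj
  rcases lt_or_gt_of_ne hij with h | h
  · exact hℓ.other_other i j (by grind) h (by grind)
  · rw [jacobiSym.quadratic_reciprocity_one_mod_four (by omega) (by grind)]
    exact hℓ.other_other j i (by grind) h (by grind)

theorem jacobiSym_prod (hℓ : IsDengLi n ℓ) {i : ℕ} {T : Finset ℕ} (hi : i ∈ Finset.Icc 2 n)
    (hT : T ⊆ Finset.Icc 2 n) (hiT : i ∉ T) : J(∏ j ∈ T, (ℓ j : ℤ) | ℓ i) = (-1) ^ T.card := by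
  rw [jacobiSym_prod_left, Finset.prod_congr rfl
    fun j hj => hℓ.jacobiSym_of_ne (hT hj) hi fun h => hiT (h ▸ hj)]
  simp

theorem injOn (hℓ : IsDengLi n ℓ) : Set.InjOn ℓ (Finset.Icc 1 n) := by
  have hself : ∀ i ∈ Finset.Icc 2 n, J(ℓ i | ℓ i) = 0 := fun i hi => by
    have hp := hℓ.prime_of_mem hi
    have : NeZero (ℓ i) := ⟨hp.ne_zero⟩
    rw [jacobiSym.eq_zero_iff_not_coprime]
    simpa using hp.ne_one
  have h1 := hℓ.first_mod
  intro i hi j hj h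
  rw [hℓ.Icc_eq, Finset.coe_insert, Set.mem_insert_iff, Finset.mem_coe] at hi hj
  rcases hi with rfl | hi <;> rcases hj with rfl | hj
  · rfl
  · have := hℓ.mod_eight_of_mem hj
    omega
  · have := hℓ.mod_eight_of_mem hi
    omega
  · by_contra hij
    have := hℓ.jacobiSym_of_ne hi hj hij
    rw [← h, hself i hi] at this
    omega

theorem two_mem (hℓ : IsDengLi n ℓ) : 2 ∈ Finset.Icc 2 n := by
  have := hℓ.two_le
  grind

section

variable {A : Finset ℕ} {r s : ℤ}

theorem dvd_prod {i : ℕ} (hi : i ∈ A) : (ℓ i : ℤ) ∣ ∏ j ∈ A, (ℓ j : ℤ) :=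
  Finset.dvd_prod_of_mem (fun j => (ℓ j : ℤ)) hi

/-- Evaluation of a norm equation modulo a prime `ℓ i` dividing the first coefficient. -/
theorem jacobiSym_of_left (hℓ : IsDengLi n ℓ) {i : ℕ} (hi : i ∈ Finset.Icc 2 n) {u w c : ℤ}
    (hu : (ℓ i : ℤ) ∣ u) (hc : J(c | ℓ i) ≠ 0) (h : u * s ^ 2 - w * r ^ 2 = c) :
    J(w | ℓ i) = J(c | ℓ i) := by
  have h1 : (ℓ i : ℤ) ∣ (-w) * r ^ 2 - c := by
    rw [← h]
    ring_nf
    exact (hu.mul_right _).neg_right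
  rw [← jacobiSym_eq_of_dvd_mul_sq_sub h1 hc, ← neg_one_mul, jacobiSym.mul_left,
    hℓ.jacobiSym_neg_one hi, one_mul]

theorem jacobiSym_of_right {i : ℕ} {u w c : ℤ} (hw : (ℓ i : ℤ) ∣ w) (hc : J(c | ℓ i) ≠ 0)
    (h : u * s ^ 2 - w * r ^ 2 = c) : J(u | ℓ i) = J(c | ℓ i) := by
  refine jacobiSym_eq_of_dvd_mul_sq_sub (r := s) ?_ hc
  rw [← h]
  ring_nf
  exact hw.mul_right _

theorem card_add_card_sdiff (hA : A ⊆ Finset.Icc 2 n) :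
    A.card + (Finset.Icc 2 n \ A).card = (Finset.Icc 2 n).card := by
  rw [add_comm, Finset.card_sdiff_add_card_eq_card hA]

theorem exists_ne_two {T : Finset ℕ} (hT : T.Nonempty) (he : Even T.card) : ∃ i ∈ T, i ≠ 2 := by
  by_contra! h
  have h1 : T = {2} := Finset.eq_singleton_iff_nonempty_unique_mem.2 ⟨hT, h⟩
  rw [h1] at he
  simp at he

/-- If `d₂ s² - d₁ r² = 1` with `d₁ d₂ = m` and `ℓ₁ ∣ d₁`, then `d₂ = 1`. -/
theorem sdiff_eq_empty (hℓ : IsDengLi n ℓ) (hA : A ⊆ Finset.Icc 2 n)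
    (h : (∏ i ∈ Finset.Icc 2 n \ A, (ℓ i : ℤ)) * s ^ 2 - (ℓ 1 * ∏ i ∈ A, (ℓ i : ℤ)) * r ^ 2 = 1) :
    Finset.Icc 2 n \ A = ∅ := by
  have hcard := card_add_card_sdiff hA
  have hodd := hℓ.odd_card
  have hB : Finset.Icc 2 n \ A ⊆ Finset.Icc 2 n := Finset.sdiff_subset
  have hAi : ∀ i ∈ A, (-1 : ℤ) ^ (Finset.Icc 2 n \ A).card = 1 := fun i hi => by
    rw [← hℓ.jacobiSym_prod (hA hi) hB (by grind)]
    exact (jacobiSym_of_right ((dvd_prod hi).mul_left _) (by simp) h).trans (by simp)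
  have hBi : ∀ i ∈ Finset.Icc 2 n \ A, J(ℓ 1 | ℓ i) * (-1 : ℤ) ^ A.card = 1 := fun i hi => by
    rw [← hℓ.jacobiSym_prod (hB hi) hA (by grind), ← jacobiSym.mul_left]
    exact (hℓ.jacobiSym_of_left (hB hi) (dvd_prod hi) (by simp) h).trans (by simp)
  by_contra hne
  -- Either `d₁ = ℓ₁`, and `ℓ₂` gives a contradiction, or `d₂` has an even number of prime factors,
  -- one of which differs from `ℓ₂` and gives a contradiction.
  rcases A.eq_empty_or_nonempty with rfl | ⟨i, hi⟩
  · have := hBi 2 (by simpa using hℓ.two_mem)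
    rw [hℓ.first_second] at this
    simp at this
  · have hBe : Even (Finset.Icc 2 n \ A).card := by
      by_contra hB'
      have := hAi i hi
      rw [(Nat.not_even_iff_odd.1 hB').neg_one_pow] at this
      omega
    obtain ⟨j, hj, hj2⟩ := exists_ne_two (Finset.nonempty_iff_ne_empty.2 hne) hBe
    have := hBi j hj
    rw [hℓ.jacobiSym_first_of_ne (hB hj) hj2, Odd.neg_one_pow (by grind)] at this
    omega

/-- The equation `d₂ s² - d₁ r² = 1` with `d₁ d₂ = m` and `ℓ₁ ∣ d₂` has no solution. -/
theorem not_first_dvd_right (hℓ : IsDengLi n ℓ) (hA : A ⊆ Finset.Icc 2 n)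
    (h : (ℓ 1 * ∏ i ∈ Finset.Icc 2 n \ A, (ℓ i : ℤ)) * s ^ 2 - (∏ i ∈ A, (ℓ i : ℤ)) * r ^ 2 = 1) :
    False := by
  have hcard := card_add_card_sdiff hA
  have hodd := hℓ.odd_card
  have hB : Finset.Icc 2 n \ A ⊆ Finset.Icc 2 n := Finset.sdiff_subset
  have hAi : ∀ i ∈ A, J(ℓ 1 | ℓ i) * (-1 : ℤ) ^ (Finset.Icc 2 n \ A).card = 1 := fun i hi => by
    rw [← hℓ.jacobiSym_prod (hA hi) hB (by grind), ← jacobiSym.mul_left]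
    exact (jacobiSym_of_right (dvd_prod hi) (by simp) h).trans (by simp)
  have hBi : ∀ i ∈ Finset.Icc 2 n \ A, (-1 : ℤ) ^ A.card = 1 := fun i hi => by
    rw [← hℓ.jacobiSym_prod (hB hi) hA (by grind)]
    exact (hℓ.jacobiSym_of_left (hB hi) ((dvd_prod hi).mul_left _) (by simp) h).trans (by simp)
  have h1 := hℓ.first_mod
  have hneg : J(-1 | ℓ 1) = -1 := by
    rw [jacobiSym.at_neg_one (by grind), ZMod.χ₄_nat_three_mod_four (by omega)]
  have hfirst : J(∏ i ∈ A, (ℓ i : ℤ) | ℓ 1) = -1 := by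
    rw [← hneg]
    refine jacobiSym_eq_of_dvd_mul_sq_sub (r := r) ?_ (by omega)
    refine ⟨(∏ i ∈ Finset.Icc 2 n \ A, (ℓ i : ℤ)) * s ^ 2, ?_⟩
    linarith
  -- `-d₁` is a square modulo `ℓ₁`, and `ℓ₂` is the only non-residue among the other primes.
  have h2 : 2 ∈ A := by
    by_contra h2
    rw [jacobiSym_prod_left, Finset.prod_congr rfl fun i hi => (hℓ.jacobiSym_comm (hA hi)).trans
      (hℓ.jacobiSym_first_of_ne (hA hi) fun e => h2 (e ▸ hi))] at hfirst
    simp at hfirst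
  have hBo : Odd (Finset.Icc 2 n \ A).card := by
    by_contra hBe
    have := hAi 2 h2
    rw [hℓ.first_second, (Nat.not_odd_iff_even.1 hBe).neg_one_pow] at this
    omega
  obtain ⟨j, hj, hj2⟩ := exists_ne_two ⟨2, h2⟩ (show Even A.card by grind)
  have := hAi j hj
  rw [hℓ.jacobiSym_first_of_ne (hA hj) hj2, hBo.neg_one_pow] at this
  omega

/-- If `d₂ s² - d₁ r² = 2` with `d₁ d₂ = m` and `ℓ₁ ∣ d₁`, then `d₁` has an even number of prime
factors congruent to `5` modulo `8`. -/
theorem even_card (hℓ : IsDengLi n ℓ) (hA : A ⊆ Finset.Icc 2 n)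
    (h : (∏ i ∈ Finset.Icc 2 n \ A, (ℓ i : ℤ)) * s ^ 2 - (ℓ 1 * ∏ i ∈ A, (ℓ i : ℤ)) * r ^ 2 = 2) :
    Even A.card := by
  by_contra hAo
  rw [Nat.not_even_iff_odd] at hAo
  have hcard := card_add_card_sdiff hA
  have hodd := hℓ.odd_card
  have h2 := hℓ.jacobiSym_two hℓ.two_mem
  by_cases hmem : 2 ∈ A
  · have := jacobiSym_of_right ((dvd_prod hmem).mul_left _) (by omega) h
    rw [h2, hℓ.jacobiSym_prod hℓ.two_mem Finset.sdiff_subset (by grind),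
      Even.neg_one_pow (by grind)] at this
    omega
  · have := hℓ.jacobiSym_of_left hℓ.two_mem
      (dvd_prod (Finset.mem_sdiff.2 ⟨hℓ.two_mem, hmem⟩)) (by omega) h
    rw [jacobiSym.mul_left, h2, hℓ.first_second, hℓ.jacobiSym_prod hℓ.two_mem hA hmem,
      hAo.neg_one_pow] at this
    omega

end

end IsDengLi

end Symbols

/-! ### The fundamental solution of the Pell equation -/

namespace IsDengLi

variable {n : ℕ} {ℓ : ℕ → ℕ}

/-- A complementary pair of divisors of `m`, sorted by which of the two contains `ℓ₁`. -/
theorem prod_split (hℓ : IsDengLi n ℓ) {T : Finset ℕ} (hT : T ⊆ Finset.Icc 1 n) :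
    ∃ A ⊆ Finset.Icc 2 n,
      (∏ i ∈ T, ℓ i = ℓ 1 * ∏ i ∈ A, ℓ i ∧
        ∏ i ∈ Finset.Icc 1 n \ T, ℓ i = ∏ i ∈ Finset.Icc 2 n \ A, ℓ i) ∨
      (∏ i ∈ T, ℓ i = ∏ i ∈ A, ℓ i ∧
        ∏ i ∈ Finset.Icc 1 n \ T, ℓ i = ℓ 1 * ∏ i ∈ Finset.Icc 2 n \ A, ℓ i) := by
  have hI := hℓ.Icc_eq
  by_cases h1 : 1 ∈ T
  · refine ⟨T.erase 1, by grind, Or.inl ⟨(Finset.mul_prod_erase T ℓ h1).symm, ?_⟩⟩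
    congr 1
    grind
  · refine ⟨T, by grind, Or.inr ⟨rfl, ?_⟩⟩
    rw [← Finset.prod_insert (by simp)]
    congr 1
    grind

/-- A solution `(x, y)` of the Pell equation with `x` odd is a square. -/
theorem exists_sqrt_of_odd (hℓ : IsDengLi n ℓ) {x y : ℕ} (hx : Odd x)
    (h : x ^ 2 = (∏ i ∈ Finset.Icc 1 n, ℓ i) * y ^ 2 + 1) :
    ∃ s r : ℕ, s ^ 2 = (∏ i ∈ Finset.Icc 1 n, ℓ i) * r ^ 2 + 1 ∧
      x = s ^ 2 + (∏ i ∈ Finset.Icc 1 n, ℓ i) * r ^ 2 ∧ y = 2 * (s * r) := by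
  have hm := hℓ.prod_Icc_mod_eight
  obtain ⟨k, rfl⟩ := hx
  have hy : Even y := by
    by_contra hy
    have h1 : Odd ((∏ i ∈ Finset.Icc 1 n, ℓ i) * y ^ 2) :=
      Odd.mul (by grind) (Nat.not_even_iff_odd.1 hy).pow
    grind
  obtain ⟨z, rfl⟩ := hy
  -- With `x = 2k + 1` and `y = 2z` the equation becomes `k (k + 1) = m z²`.
  have hz : k * (k + 1) = (∏ i ∈ Finset.Icc 1 n, ℓ i) * z ^ 2 := by nlinarith
  obtain ⟨T, hT, r, s, hr, hs, rfl⟩ := exists_eq_prod_mul_sq_of_coprime _ ℓ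
    (fun i hi => hℓ.prime i (by grind) (by grind)) hℓ.injOn (by simp) hz
  obtain ⟨A, hA, ⟨h1, h2⟩ | ⟨h1, h2⟩⟩ := hℓ.prod_split hT
  · have hB := hℓ.sdiff_eq_empty (s := s) (r := r) hA (by
      rw [h1] at hr
      rw [h2] at hs
      zify at hr hs
      linarith)
    have hAI : A = Finset.Icc 2 n := subset_antisymm hA (Finset.sdiff_eq_empty_iff_subset.1 hB)
    rw [hB, Finset.prod_empty] at h2
    rw [h2] at hs
    rw [h1, hAI, ← hℓ.prod_eq] at hr
    exact ⟨s, r, by linarith, by linarith, by ring⟩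
  · refine (hℓ.not_first_dvd_right (s := s) (r := r) hA ?_).elim
    rw [h1] at hr
    rw [h2] at hs
    zify at hr hs
    linarith

/-- A solution `(x, y)` of the Pell equation with `x` even satisfies `x ≡ 4 mod 8`: one has
`x - 1 = d₁ r²` with `r` odd and `d₁ ≡ 3 mod 8`. -/
theorem mod_eight_of_even (hℓ : IsDengLi n ℓ) {x y : ℕ} (hx : Even x)
    (h : x ^ 2 = (∏ i ∈ Finset.Icc 1 n, ℓ i) * y ^ 2 + 1) : x % 8 = 4 := by
  obtain ⟨j, rfl⟩ := hx
  -- Now `x = 2k + 2` and `(x - 1) (x + 1) = (2k + 1) (2k + 3)`.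
  obtain ⟨k, rfl⟩ : ∃ k, j = k + 1 := ⟨j - 1, by
    have : j ≠ 0 := by
      rintro rfl
      simp at h
    omega⟩
  have hcop : (2 * k + 1).Coprime (2 * k + 1 + 2) := by
    rw [Nat.coprime_self_add_right, Nat.coprime_two_right]
    simp
  have hk : (2 * k + 1) * (2 * k + 1 + 2) = (∏ i ∈ Finset.Icc 1 n, ℓ i) * y ^ 2 := by nlinarith
  obtain ⟨T, hT, r, s, hr, hs, -⟩ := exists_eq_prod_mul_sq_of_coprime _ ℓ
    (fun i hi => hℓ.prime i (by grind) (by grind)) hℓ.injOn hcop hk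
  have hsq : ∀ {d a c : ℕ}, 2 * c + 1 = d * a ^ 2 → a ^ 2 % 8 = 1 := by
    intro d a c h
    have ha : Odd a := by
      by_contra ha
      have h2 : Even (d * a ^ 2) :=
        ((Nat.not_odd_iff_even.1 ha).pow_of_ne_zero two_ne_zero).mul_left d
      grind
    have : a % 8 = 1 ∨ a % 8 = 3 ∨ a % 8 = 5 ∨ a % 8 = 7 := by grind
    rw [Nat.pow_mod]
    rcases this with h | h | h | h <;> simp [h]
  have hr2 := hsq hr
  have hs2 := hsq (c := k + 1) hs
  obtain ⟨A, hA, ⟨h1, h2⟩ | ⟨h1, h2⟩⟩ := hℓ.prod_split hT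
  · have hev := hℓ.even_card (s := s) (r := r) hA (by
      rw [h1] at hr
      rw [h2] at hs
      zify at hr hs
      linarith)
    have hA8 := hℓ.prod_mod_eight hA
    rw [if_pos hev] at hA8
    have : (2 * k + 1) % 8 = 3 := by
      rw [hr, h1, Nat.mul_mod, hr2, Nat.mul_mod (ℓ 1), hA8, hℓ.first_mod]
    omega
  -- If `ℓ₁ ∣ d₂`, then `(d₁, d₂)` is `(1, 7)` or `(5, 3)` modulo `8`, but `d₂ - d₁` should be `2`.
  · exfalso
    have hcard := card_add_card_sdiff hA
    have hodd := hℓ.odd_card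
    have hA8 := hℓ.prod_mod_eight hA
    have hB8 := hℓ.prod_mod_eight (T := Finset.Icc 2 n \ A) Finset.sdiff_subset
    have e1 : (2 * k + 1) % 8 = (∏ i ∈ A, ℓ i) % 8 := by
      rw [hr, h1, Nat.mul_mod, hr2]
      simp
    have e2 : (2 * k + 1 + 2) % 8 = 3 * ((∏ i ∈ Finset.Icc 2 n \ A, ℓ i) % 8) % 8 := by
      rw [hs, h2, Nat.mul_mod, hs2, Nat.mul_mod (ℓ 1), hℓ.first_mod]
      simp
    split_ifs at hA8 hB8 with ha hb hb
    · grind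
    · omega
    · omega
    · grind

theorem not_isSquare (hℓ : IsDengLi n ℓ) : ¬ IsSquare ((∏ i ∈ Finset.Icc 1 n, ℓ i : ℕ) : ℤ) := by
  rintro ⟨z, hz⟩
  have hm := hℓ.prod_Icc_mod_eight
  have h8 : (z * z) % 8 = 7 := by omega
  have : z % 8 = 0 ∨ z % 8 = 1 ∨ z % 8 = 2 ∨ z % 8 = 3 ∨ z % 8 = 4 ∨ z % 8 = 5 ∨ z % 8 = 6 ∨
    z % 8 = 7 := by omega
  rw [Int.mul_emod] at h8
  rcases this with h | h | h | h | h | h | h | h <;> simp [h] at h8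

theorem exists_isFundamental (hℓ : IsDengLi n ℓ) :
    ∃ f : Pell.Solution₁ ((∏ i ∈ Finset.Icc 1 n, ℓ i : ℕ) : ℤ), Pell.IsFundamental f := by
  refine Pell.IsFundamental.exists_of_not_isSquare ?_ hℓ.not_isSquare
  have := hℓ.prod_Icc_mod_eight
  omega

/-- A generator of the solutions of the Pell equation up to sign is not a square up to sign, as
the solutions contain an element of infinite order. -/
theorem ne_sq_of_generator (hℓ : IsDengLi n ℓ)
    {a : Pell.Solution₁ ((∏ i ∈ Finset.Icc 1 n, ℓ i : ℕ) : ℤ)}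
    (ha : ∀ b, ∃ k : ℤ, b = a ^ k ∨ b = -a ^ k) (d : Pell.Solution₁ _) :
    a ≠ d ^ 2 ∧ a ≠ -d ^ 2 := by
  obtain ⟨f, hf⟩ := hℓ.exists_isFundamental
  obtain ⟨j, hj⟩ := ha f
  obtain ⟨k, hk⟩ := ha d
  have hd : d ^ 2 = a ^ (2 * k) := by
    rcases hk with rfl | rfl
    · rw [← zpow_natCast, ← zpow_mul, mul_comm]; rfl
    · rw [neg_sq, ← zpow_natCast, ← zpow_mul, mul_comm]; rfl
  have hf2 : f ^ 2 = (a ^ 2) ^ j := by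
    rcases hj with rfl | rfl
    · rw [← zpow_natCast, ← zpow_natCast, ← zpow_mul, ← zpow_mul, mul_comm]
    · rw [neg_sq, ← zpow_natCast, ← zpow_natCast, ← zpow_mul, ← zpow_mul, mul_comm]
  -- If `a ^ 2` had finite order, so would `f ^ 2`.
  have key : ¬ (a ^ 2) ^ (2 * k - 1) = 1 := by
    intro h
    have : f ^ (2 * (2 * k - 1)) = 1 := by
      rw [zpow_mul, show f ^ (2 : ℤ) = (a ^ 2) ^ j by rw [← hf2]; rfl, ← zpow_mul, mul_comm,
        zpow_mul, h, one_zpow]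
    rw [hf.zpow_eq_one_iff] at this
    omega
  have h2 : a ^ 2 ≠ (a ^ (2 * k)) ^ 2 := by
    intro h
    apply key
    rw [zpow_sub_one, mul_inv_eq_one]
    rw [← zpow_natCast, ← zpow_mul, mul_comm, zpow_mul, zpow_natCast]
    exact h.symm
  constructor
  · rintro h
    rw [← hd, ← h] at h2
    exact h2 rfl
  · intro h
    rw [← hd] at h2
    apply h2
    conv_lhs => rw [h]
    rw [neg_sq]

/-- A generator `(x, y)` of the solutions of the Pell equation up to sign has `x ≡ 4 mod 8`. -/
theorem fundamental_mod_eight (hℓ : IsDengLi n ℓ)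
    {a : Pell.Solution₁ ((∏ i ∈ Finset.Icc 1 n, ℓ i : ℕ) : ℤ)}
    (ha : ∀ b, ∃ k : ℤ, b = a ^ k ∨ b = -a ^ k) : a.x % 8 = 4 := by
  have h : a.x.natAbs ^ 2 = (∏ i ∈ Finset.Icc 1 n, ℓ i) * a.y.natAbs ^ 2 + 1 := by
    zify
    rw [sq_abs, sq_abs, a.prop_x]
    push_cast
    ring
  rcases Nat.even_or_odd a.x.natAbs with he | ho
  · have := hℓ.mod_eight_of_even he h
    omega
  · exfalso
    obtain ⟨s, r, h1, h2, h3⟩ := hℓ.exists_sqrt_of_odd ho h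
    have hs : (s : ℤ) ^ 2 - ((∏ i ∈ Finset.Icc 1 n, ℓ i : ℕ) : ℤ) * (r : ℤ) ^ 2 = 1 := by
      zify at h1 ⊢
      linarith
    have hs' : (s : ℤ) ^ 2 - ((∏ i ∈ Finset.Icc 1 n, ℓ i : ℕ) : ℤ) * (-(r : ℤ)) ^ 2 = 1 := by
      rw [neg_sq, hs]
    -- The signs of `x` and `y` decide which of `±(s ± r√m)²` is `x + y√m`.
    have n1 := hℓ.ne_sq_of_generator ha (Pell.Solution₁.mk s r hs)
    have n2 := hℓ.ne_sq_of_generator ha (Pell.Solution₁.mk s (-r) hs')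
    zify at h2 h3
    rcases abs_choice a.x with hx | hx <;> rcases abs_choice a.y with hy | hy
    · refine n1.1 (Pell.Solution₁.ext ?_ ?_) <;>
        simp [sq, Pell.Solution₁.x_mul, Pell.Solution₁.y_mul] <;> linarith
    · refine n2.1 (Pell.Solution₁.ext ?_ ?_) <;>
        simp [sq, Pell.Solution₁.x_mul, Pell.Solution₁.y_mul] <;> linarith
    · refine n2.2 (Pell.Solution₁.ext ?_ ?_) <;>
        simp [sq, Pell.Solution₁.x_mul, Pell.Solution₁.y_mul] <;> linarith
    · refine n1.2 (Pell.Solution₁.ext ?_ ?_) <;>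
        simp [sq, Pell.Solution₁.x_mul, Pell.Solution₁.y_mul] <;> linarith

end IsDengLi

/-! ### Discretely valued extensions of the field of dyadic numbers -/

section Valued

open WithZero Filter Topology

variable {L : Type*} [Field L] [Valued L ℤᵐ⁰]

theorem Valued.isClosed_setOf_le (c : ℤᵐ⁰) : IsClosed {x : L | Valued.v x ≤ c} := by
  rw [← isOpen_compl_iff, isOpen_iff_mem_nhds]
  intro x hx
  have hx' : c < Valued.v x := by simpa using hx
  filter_upwards [Valued.locally_const (x := x) hx'.ne_zero] with y hy
  simpa using hx'.trans_eq (Eq.symm hy)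

theorem Valued.map_two_pow (h2 : Valued.v (2 : L) = exp (-2)) (s : ℕ) :
    Valued.v ((2 : L) ^ s) = exp (-(2 * s) : ℤ) := by
  rw [map_pow, h2, ← exp_nsmul, nsmul_eq_mul]
  congr 1
  ring

/-- The balls with radii `exp (-n)` form a basis of neighbourhoods. This needs elements of
arbitrarily small nonzero valuation, here the powers of `2`. -/
theorem Valued.mem_nhds_iff_exp (h2 : Valued.v (2 : L) = exp (-2)) {s : Set L} {a : L} :
    s ∈ 𝓝 a ↔ ∃ n : ℕ, {x : L | Valued.v (x - a) ≤ exp (-n : ℤ)} ⊆ s := by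
  constructor
  · intro h
    obtain ⟨γ, hγ⟩ := Valued.mem_nhds.1 h
    obtain ⟨n, hn⟩ := exists_exp_neg_natCast_lt
      (x := MonoidWithZeroHom.ValueGroup₀.embedding γ.1) (by simp)
    refine ⟨n, fun x hx => hγ ?_⟩
    simp only [Set.mem_ofPred_eq, Valuation.restrict_lt_iff_lt_embedding] at hx ⊢
    exact lt_of_le_of_lt hx hn
  · rintro ⟨n, hn⟩
    rw [Valued.mem_nhds]
    have h0 : (2 : L) ^ n ≠ 0 := by
      rw [← (Valued.v : Valuation L ℤᵐ⁰).ne_zero_iff, Valued.map_two_pow h2]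
      simp
    refine ⟨Units.mk0 (Valued.v.restrict ((2 : L) ^ n)) (by simpa using h0), fun x hx => hn ?_⟩
    simp only [Set.mem_ofPred_eq, Units.val_mk0, Valuation.restrict_lt_iff,
      Valued.map_two_pow h2] at hx ⊢
    exact hx.le.trans (exp_le_exp.2 (by omega))

theorem Valued.tendsto_iff_exp (h2 : Valued.v (2 : L) = exp (-2)) {ι : Type*} {l : Filter ι}
    {f : ι → L} {a : L} :
    Tendsto f l (𝓝 a) ↔ ∀ n : ℕ, ∀ᶠ i in l, Valued.v (f i - a) ≤ exp (-n : ℤ) := by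
  constructor
  · intro h n
    exact h ((Valued.mem_nhds_iff_exp h2).2 ⟨n, subset_rfl⟩)
  · intro h s hs
    obtain ⟨n, hn⟩ := (Valued.mem_nhds_iff_exp h2).1 hs
    exact (h n).mono fun i hi => hn hi

theorem Valued.tsum_le [CompleteSpace L] {f : ℕ → L} {c : ℤᵐ⁰} (h : ∀ k, Valued.v (f k) ≤ c) :
    Valued.v (∑' k, f k) ≤ c := by
  by_cases hf : Summable f
  · exact (Valued.isClosed_setOf_le c).mem_of_tendsto hf.hasSum
      (Eventually.of_forall fun s => Valuation.map_sum_le _ fun i _ => h i)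
  -- A divergent sum has the value `0`.
  · rw [tsum_eq_zero_of_not_summable hf]
    simp

theorem Valued.map_int_le_one (k : ℤ) : Valued.v (k : L) ≤ 1 := by
  induction k using Int.induction_on with
  | zero => simp
  | succ i ih =>
    rw [Int.cast_add, Int.cast_one]
    exact Valuation.map_add_le _ ih (by simp)
  | pred i ih =>
    rw [Int.cast_sub, Int.cast_one]
    exact Valuation.map_sub_le _ ih (by simp)

theorem Valued.map_int_of_odd (h2 : Valued.v (2 : L) = exp (-2)) {k : ℤ} (hk : Odd k) :
    Valued.v (k : L) = 1 := by
  obtain ⟨j, rfl⟩ := hk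
  have : Valued.v ((2 : L) * j) < 1 := by
    rw [map_mul, h2]
    refine lt_of_le_of_lt (mul_le_of_le_one_right' (Valued.map_int_le_one j)) ?_
    rw [← exp_zero, exp_lt_exp]
    norm_num
  have h := Valuation.map_one_add_of_lt _ this
  rw [← h]
  push_cast
  rw [add_comm]

/-- The valuation of a positive integer `k`, in terms of the exponent `s` of `2` in `k`. -/
theorem Valued.exists_map_nat_eq (h2 : Valued.v (2 : L) = exp (-2)) {k : ℕ} (hk : k ≠ 0) :
    ∃ s q : ℕ, Odd q ∧ k = 2 ^ s * q ∧ Valued.v (k : L) = exp (-(2 * s) : ℤ) := by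
  obtain ⟨s, q, hq, rfl⟩ := Nat.exists_eq_two_pow_mul_odd hk
  refine ⟨s, q, hq, rfl, ?_⟩
  have := Valued.map_int_of_odd h2 (k := q) (by exact_mod_cast hq)
  rw [Nat.cast_mul, map_mul, Nat.cast_pow, Nat.cast_ofNat, Valued.map_two_pow h2]
  rw [Int.cast_natCast] at this
  rw [this, mul_one]

/-- Integers have even valuation, so that `v(k) ≥ 2s - 1` already implies `2 ^ s ∣ k`. -/
theorem Valued.two_pow_dvd_of_le (h2 : Valued.v (2 : L) = exp (-2)) {k : ℤ} {s : ℕ}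
    (h : Valued.v (k : L) ≤ exp (1 - 2 * s : ℤ)) : (2 : ℤ) ^ s ∣ k := by
  rcases eq_or_ne k 0 with rfl | hk
  · simp
  obtain ⟨t, q, hq, hkt, hv⟩ := Valued.exists_map_nat_eq (L := L) h2 (Int.natAbs_ne_zero.2 hk)
  have hv' : Valued.v (k : L) = exp (-(2 * t) : ℤ) := by
    rw [← hv]
    rcases Int.natAbs_eq k with h | h
    · conv_lhs => rw [h, Int.cast_natCast]
    · conv_lhs => rw [h, Int.cast_neg, Int.cast_natCast, Valuation.map_neg]
  rw [hv', exp_le_exp] at h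
  rw [← Int.dvd_natAbs, hkt]
  push_cast
  exact (pow_dvd_pow 2 (by omega)).mul_right _

theorem Valued.le_exp_neg_one {x : L} : Valued.v x ≤ exp (-1) ↔ Valued.v x < 1 := by
  rw [← lt_mul_exp_iff_le (by simp), ← exp_add]
  simp

end Valued

/-! ### The logarithm over an extension of the dyadic numbers -/

section Log

open WithZero Filter Topology

variable {L : Type*} [Field L] [Valued L ℤᵐ⁰]

/-- The logarithm series `log (1 + x) = ∑_{k ≥ 1} (-1)^(k-1) x^k / k` in a valued field. -/
noncomputable def seriesLog (u : L) : L :=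
  ∑' k : ℕ, (-1) ^ k * (u - 1) ^ (k + 1) / ((k : L) + 1)

theorem Valued.natCast_ne_zero (h2 : Valued.v (2 : L) = exp (-2)) {k : ℕ} (hk : k ≠ 0) :
    (k : L) ≠ 0 := by
  obtain ⟨s, -, -, -, h⟩ := Valued.exists_map_nat_eq h2 hk
  rw [← (Valued.v : Valuation L ℤᵐ⁰).ne_zero_iff, h]
  exact exp_ne_zero

theorem Valued.map_pow_le_exp {x : L} {c : ℤ} (hx : Valued.v x ≤ exp c) (k : ℕ) :
    Valued.v (x ^ k) ≤ exp (k * c) := by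
  rw [map_pow, ← nsmul_eq_mul, exp_nsmul]
  exact pow_le_pow_left₀ zero_le hx k

theorem Valued.map_mul_le_exp {x y : L} {a b : ℤ} (hx : Valued.v x ≤ exp a)
    (hy : Valued.v y ≤ exp b) : Valued.v (x * y) ≤ exp (a + b) := by
  rw [map_mul, exp_add]
  exact mul_le_mul' hx hy

/-- The terms of the logarithm series tend to `0`: a power `2 ^ s` dividing `k + 1` satisfies
`4 s ≤ k + 5`. -/
theorem Valued.map_pow_div_le (h2 : Valued.v (2 : L) = exp (-2)) {x : L}
    (hx : Valued.v x ≤ exp (-1)) {n k : ℕ} (hk : 2 * n + 4 ≤ k + 1) :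
    Valued.v (x ^ (k + 1) / ((k : L) + 1)) ≤ exp (-n : ℤ) := by
  obtain ⟨s, q, hq, hks, hv⟩ := Valued.exists_map_nat_eq (L := L) h2 k.succ_ne_zero
  have hs : 4 * s ≤ k + 1 + 4 := by
    have h1 : 2 ^ s ≤ k + 1 := by
      have := hq.pos
      rw [Nat.succ_eq_add_one] at hks
      rw [hks]
      exact Nat.le_mul_of_pos_right _ this
    refine le_trans ?_ (Nat.add_le_add_right h1 4)
    clear hks hv h1
    induction s with
    | zero => simp
    | succ s ih =>
      rcases Nat.lt_or_ge s 2 with h | h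
      · interval_cases s <;> simp
      · have := Nat.pow_le_pow_right two_pos h
        rw [pow_succ]
        omega
  rw [Nat.succ_eq_add_one, Nat.cast_add, Nat.cast_one] at hv
  rw [map_div₀, hv, div_le_iff₀ (by simp), ← exp_add]
  refine (Valued.map_pow_le_exp hx _).trans (exp_le_exp.2 ?_)
  push_cast
  omega

theorem tendsto_two_pow_zero (h2 : Valued.v (2 : L) = exp (-2)) :
    Tendsto (fun n : ℕ => (2 : L) ^ n) atTop (𝓝 0) := by
  rw [Valued.tendsto_iff_exp h2]
  intro M
  filter_upwards [eventually_ge_atTop M] with n hn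
  rw [sub_zero, Valued.map_two_pow h2, exp_le_exp]
  omega

/-- `2`-adically, `C(2^n - 1, k)` tends to `C(-1, k) = (-1)^k`. -/
theorem tendsto_choose_two_pow_sub_one (h2 : Valued.v (2 : L) = exp (-2)) (k : ℕ) :
    Tendsto (fun n : ℕ => ((2 ^ n - 1).choose k : L)) atTop (𝓝 ((-1) ^ k)) := by
  induction k with
  | zero => simp
  | succ k ih =>
    have hk : ((k : L) + 1) ≠ 0 := by
      exact_mod_cast Valued.natCast_ne_zero h2 k.succ_ne_zero
    have h : ∀ n : ℕ, ((2 ^ n - 1).choose (k + 1) : L) =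
        2 ^ n * ((2 ^ n - 1).choose k : L) / ((k : L) + 1) - ((2 ^ n - 1).choose k : L) := by
      intro n
      obtain ⟨N, hN⟩ : ∃ N, 2 ^ n = N + 1 := ⟨2 ^ n - 1, by have := Nat.two_pow_pos n; omega⟩
      rw [eq_sub_iff_add_eq, eq_div_iff hk]
      have e1 := Nat.add_one_mul_choose_eq N k
      rw [Nat.choose_succ_succ] at e1
      have e2 : (2 : L) ^ n = (N : L) + 1 := by exact_mod_cast congrArg (Nat.cast (R := L)) hN
      rw [e2, hN, Nat.add_sub_cancel]
      have := congrArg (Nat.cast (R := L)) e1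
      push_cast at this
      rw [this, add_comm]
    simp_rw [h]
    have := (((tendsto_two_pow_zero h2).mul ih).div_const ((k : L) + 1)).sub ih
    simpa [pow_succ] using this

/-- The binomial expansion of `((1 + x) ^ N - 1) / N`, which resembles the logarithm series as
`C(N, k + 1) / N = C(N - 1, k) / (k + 1)`. -/
theorem one_add_pow_sub_one_div (h2 : Valued.v (2 : L) = exp (-2)) (x : L) (N : ℕ) (hN : N ≠ 0) :
    ((1 + x) ^ N - 1) / (N : L) =
      ∑ k ∈ Finset.range N, ((N - 1).choose k : L) * (x ^ (k + 1) / ((k : L) + 1)) := by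
  have hN' := Valued.natCast_ne_zero h2 hN
  rw [div_eq_iff hN', add_comm, add_pow, Finset.sum_range_succ', Finset.sum_mul]
  simp only [one_pow, mul_one, pow_zero, Nat.choose_zero_right, Nat.cast_one, add_sub_cancel_right]
  refine Finset.sum_congr rfl fun k _ => ?_
  have hk : ((k : L) + 1) ≠ 0 := by
    exact_mod_cast Valued.natCast_ne_zero h2 k.succ_ne_zero
  obtain ⟨M, rfl⟩ := Nat.exists_eq_succ_of_ne_zero hN
  have e1 := congrArg (Nat.cast (R := L)) (Nat.add_one_mul_choose_eq M k)
  push_cast at e1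
  simp only [Nat.succ_eq_add_one, Nat.add_sub_cancel]
  push_cast
  field_simp
  linear_combination (-x ^ (k + 1)) * e1

theorem Valued.map_mul_sub_one_le {u w : L} {c : ℤ} (hc : c ≤ 0)
    (hu : Valued.v (u - 1) ≤ exp c) (hw : Valued.v (w - 1) ≤ exp c) :
    Valued.v (u * w - 1) ≤ exp c := by
  rw [show u * w - 1 = (u - 1) * (w - 1) + (u - 1) + (w - 1) by ring]
  refine Valuation.map_add_le _ (Valuation.map_add_le _ ?_ hu) hw
  exact (Valued.map_mul_le_exp hu hw).trans (exp_le_exp.2 (by omega))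

@[simp]
theorem seriesLog_one : seriesLog (1 : L) = 0 := by
  simp [seriesLog]

theorem Valued.map_neg_sub_one_le (h2 : Valued.v (2 : L) = exp (-2)) {u : L} {c : ℤ}
    (hc : -2 ≤ c) (hu : Valued.v (u - 1) ≤ exp c) : Valued.v (-u - 1) ≤ exp c := by
  rw [show -u - 1 = -(u - 1) - 2 by ring]
  refine Valuation.map_sub_le _ (by rwa [Valuation.map_neg]) ?_
  rw [h2, exp_le_exp]
  exact hc

theorem Valued.nonarchimedeanAddGroup (h2 : Valued.v (2 : L) = exp (-2)) :
    NonarchimedeanAddGroup L where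
  is_nonarchimedean U hU := by
    obtain ⟨n, hn⟩ := (Valued.mem_nhds_iff_exp h2).1 hU
    let B : AddSubgroup L :=
      { carrier := {x | Valued.v x ≤ exp (-n : ℤ)}
        add_mem' := fun ha hb => Valuation.map_add_le (Valued.v : Valuation L ℤᵐ⁰) ha hb
        zero_mem' := by simp
        neg_mem' := fun ha => by simpa using ha }
    refine ⟨⟨B, B.isOpen_of_mem_nhds (g := 0) ?_⟩, fun x hx => hn ?_⟩
    · exact (Valued.mem_nhds_iff_exp h2).2 ⟨n, fun x hx => by
        change Valued.v (x - 0) ≤ _ at hx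
        rwa [sub_zero] at hx⟩
    · change Valued.v (x - 0) ≤ _
      rw [sub_zero]
      exact hx

variable [CompleteSpace L]

theorem summable_log (h2 : Valued.v (2 : L) = exp (-2)) {x : L} (hx : Valued.v x ≤ exp (-1)) :
    Summable fun k : ℕ => (-1) ^ k * (x ^ (k + 1) / ((k : L) + 1)) := by
  have := Valued.nonarchimedeanAddGroup h2
  refine NonarchimedeanAddGroup.summable_of_tendsto_cofinite_zero ?_
  rw [Nat.cofinite_eq_atTop, Valued.tendsto_iff_exp h2]
  intro n
  filter_upwards [eventually_ge_atTop (2 * n + 4)] with k hk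
  rw [sub_zero, map_mul, map_pow, Valuation.map_neg, map_one, one_pow, one_mul]
  exact Valued.map_pow_div_le h2 hx (by omega)

variable [T0Space L]

/-- The logarithm as a limit of difference quotients: `log u = lim (u ^ (2 ^ n) - 1) / 2 ^ n`. This
is what makes it a homomorphism. -/
theorem tendsto_seriesLog (h2 : Valued.v (2 : L) = exp (-2)) {u : L}
    (hu : Valued.v (u - 1) ≤ exp (-1)) :
    Tendsto (fun n : ℕ => (u ^ 2 ^ n - 1) / 2 ^ n) atTop (𝓝 (seriesLog u)) := by
  obtain ⟨x, rfl⟩ : ∃ x, u = 1 + x := ⟨u - 1, by ring⟩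
  rw [add_sub_cancel_left] at hu
  rw [Valued.tendsto_iff_exp h2]
  intro M
  -- Termwise, both series differ by `C(2 ^ n - 1, k) - (-1) ^ k` times a null sequence in `k`:
  -- large `k` are harmless, and finitely many `k` remain.
  have hev : ∀ᶠ n : ℕ in atTop, ∀ k ∈ Finset.range (2 * M + 4),
      Valued.v ((((2 ^ n - 1).choose k : L) - (-1) ^ k) * (x ^ (k + 1) / ((k : L) + 1)))
        ≤ exp (-M : ℤ) := by
    rw [eventually_all_finset]
    intro k _
    have h := ((tendsto_choose_two_pow_sub_one h2 k).sub_const ((-1) ^ k)).mul_const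
      (x ^ (k + 1) / ((k : L) + 1))
    rw [sub_self, zero_mul, Valued.tendsto_iff_exp h2] at h
    simpa using h M
  filter_upwards [hev] with n hn
  have hsum : ∀ k ∉ Finset.range (2 ^ n),
      ((2 ^ n - 1).choose k : L) * (x ^ (k + 1) / ((k : L) + 1)) = 0 := by
    intro k hk
    have := Nat.two_pow_pos n
    rw [Nat.choose_eq_zero_of_lt (by simp at hk; omega), Nat.cast_zero, zero_mul]
  have e1 := one_add_pow_sub_one_div h2 x (2 ^ n) (by positivity)
  rw [Nat.cast_pow, Nat.cast_ofNat, ← tsum_eq_sum (L := .unconditional ℕ) hsum] at e1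
  have e2 : seriesLog (1 + x) = ∑' k : ℕ, (-1) ^ k * (x ^ (k + 1) / ((k : L) + 1)) := by
    simp only [seriesLog, add_sub_cancel_left, mul_div_assoc]
  rw [e1, e2, ← Summable.tsum_sub (L := .unconditional ℕ) (summable_of_ne_finset_zero hsum)
    (summable_log h2 hu)]
  refine Valued.tsum_le fun k => ?_
  rw [← sub_mul]
  by_cases hk : k ∈ Finset.range (2 * M + 4)
  · exact hn k hk
  · rw [map_mul]
    refine (mul_le_of_le_one_left' ?_).trans (Valued.map_pow_div_le h2 hu (n := M) ?_)
    · have := Valued.map_int_le_one (L := L) (((2 ^ n - 1).choose k : ℤ) - (-1) ^ k)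
      push_cast at this
      exact this
    · simp at hk
      omega

theorem seriesLog_mul (h2 : Valued.v (2 : L) = exp (-2)) {u w : L}
    (hu : Valued.v (u - 1) ≤ exp (-1)) (hw : Valued.v (w - 1) ≤ exp (-1)) :
    seriesLog (u * w) = seriesLog u + seriesLog w := by
  have hlu := tendsto_seriesLog h2 hu
  have hlw := tendsto_seriesLog h2 hw
  have huw := tendsto_seriesLog h2 (Valued.map_mul_sub_one_le (by norm_num) hu hw)
  have h20 : (2 : L) ≠ 0 := by exact_mod_cast Valued.natCast_ne_zero h2 two_ne_zero
  -- With `a = u ^ 2 ^ n - 1`, `b = w ^ 2 ^ n - 1` one has `(uw) ^ 2 ^ n - 1 = ab + a + b`.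
  have h := (((tendsto_two_pow_zero h2).mul hlu).mul hlw).add (hlu.add hlw)
  rw [zero_mul, zero_mul, zero_add] at h
  refine tendsto_nhds_unique huw (h.congr fun n => ?_)
  rw [mul_pow]
  field_simp
  ring

theorem seriesLog_neg_one (h2 : Valued.v (2 : L) = exp (-2)) : seriesLog (-1 : L) = 0 := by
  have h : Valued.v ((-1 : L) - 1) ≤ exp (-1) := by
    rw [show (-1 : L) - 1 = -2 by ring, Valuation.map_neg, h2, exp_le_exp]
    norm_num
  have h1 := seriesLog_mul h2 h h
  rw [neg_mul_neg, one_mul, seriesLog_one, ← two_mul] at h1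
  have h20 : (2 : L) ≠ 0 := by exact_mod_cast Valued.natCast_ne_zero h2 two_ne_zero
  exact (mul_eq_zero.1 h1.symm).resolve_left h20

theorem seriesLog_neg (h2 : Valued.v (2 : L) = exp (-2)) {u : L}
    (hu : Valued.v (u - 1) ≤ exp (-1)) : seriesLog (-u) = seriesLog u := by
  have h : Valued.v ((-1 : L) - 1) ≤ exp (-1) :=
    Valued.map_neg_sub_one_le h2 (by norm_num) (by simp)
  rw [← neg_one_mul, seriesLog_mul h2 h hu, seriesLog_neg_one h2, zero_add]

/-- The logarithm is isometric near `1`. -/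
theorem map_seriesLog (h2 : Valued.v (2 : L) = exp (-2)) {u : L}
    (hu : Valued.v (u - 1) ≤ exp (-3)) : Valued.v (seriesLog u) = Valued.v (u - 1) := by
  obtain ⟨x, rfl⟩ : ∃ x, u = 1 + x := ⟨u - 1, by ring⟩
  rw [add_sub_cancel_left] at hu ⊢
  rcases eq_or_ne x 0 with rfl | hx0
  · simp
  have hs := summable_log h2 (hu.trans (exp_le_exp.2 (by norm_num)))
  have e2 : seriesLog (1 + x) = ∑' k : ℕ, (-1) ^ k * (x ^ (k + 1) / ((k : L) + 1)) := by
    simp only [seriesLog, add_sub_cancel_left, mul_div_assoc]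
  -- The term in `x ^ (k + 2)` is smaller than `x`, since `v(x) ≥ 3` and `v(k + 2) ≤ 2 (k + 1)`.
  have htail : Valued.v (∑' k : ℕ, (-1) ^ (k + 1) * (x ^ (k + 1 + 1) / (((k + 1 : ℕ) : L) + 1))) ≤
      Valued.v x * exp (-1) := by
    refine Valued.tsum_le fun k => ?_
    rw [map_mul, map_pow, Valuation.map_neg, map_one, one_pow, one_mul, pow_succ', mul_div_assoc,
      map_mul]
    refine mul_le_mul_right ?_ _
    obtain ⟨s, q, hq, hks, hv⟩ := Valued.exists_map_nat_eq (L := L) h2 (k + 1).succ_ne_zero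
    have hle : s ≤ k + 1 := by
      have h1 : 2 ^ s ≤ k + 1 + 1 := by
        have := hq.pos
        rw [Nat.succ_eq_add_one] at hks
        rw [hks]
        exact Nat.le_mul_of_pos_right _ this
      have := Nat.lt_two_pow_self (n := s)
      omega
    rw [Nat.succ_eq_add_one, Nat.cast_add _ 1, Nat.cast_one] at hv
    rw [map_div₀, hv, div_le_iff₀ (by simp), ← exp_add]
    refine (Valued.map_pow_le_exp hu _).trans (exp_le_exp.2 ?_)
    push_cast
    omega
  rw [e2, hs.tsum_eq_zero_add]
  refine (Valuation.map_add_eq_of_lt_left _ (htail.trans_lt ?_)).trans (by simp)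
  have hpos : 0 < Valued.v x := zero_lt_iff.2 (by simpa using hx0)
  have hlt : exp (-1 : ℤ) < 1 := by
    rw [← exp_zero, exp_lt_exp]
    norm_num
  simpa using mul_lt_mul_of_pos_left hlt hpos

end Log

/-! ### Logarithms of principal units of a ramified quadratic extension -/

section LogImage

open WithZero Filter Topology

variable {L : Type*} [Field L] [Valued L ℤᵐ⁰]

theorem Valued.map_eq_or_le {x : L} {c : ℤ} (h : Valued.v x ≤ exp c) :
    Valued.v x = exp c ∨ Valued.v x ≤ exp (c - 1) := by
  rcases h.eq_or_lt with h | h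
  · exact Or.inl h
  · right
    rw [← lt_mul_exp_iff_le (by simp), ← exp_add]
    simpa using h

/-- If the residue field has two elements, the sum of two elements of the same valuation has
smaller valuation. -/
theorem Valued.map_add_le_of_eq (hres : ∀ x : L, Valued.v x = 1 → Valued.v (x - 1) < 1) {a b : L}
    {c : ℤ} (ha : Valued.v a = exp c) (hb : Valued.v b = exp c) :
    Valued.v (a + b) ≤ exp (c - 1) := by
  have hb0 : b ≠ 0 := by
    rw [← (Valued.v : Valuation L ℤᵐ⁰).ne_zero_iff, hb]
    simp
  have h := hres (-(a / b)) (by rw [Valuation.map_neg, map_div₀, ha, hb, div_self (by simp)])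
  rw [show -(a / b) - 1 = -((a + b) / b) by field_simp; ring, Valuation.map_neg, map_div₀, hb,
    div_lt_one₀ (by simp)] at h
  refine (Valued.map_eq_or_le h.le).resolve_left h.ne

theorem Valued.map_eq_one_of_principal {u : L} (hu : Valued.v (u - 1) ≤ exp (-1)) :
    Valued.v u = 1 := by
  have := Valuation.map_one_add_of_lt _ (Valued.le_exp_neg_one.1 hu)
  simpa using this

theorem Valued.map_inv_sub_one {u : L} (hu : Valued.v (u - 1) ≤ exp (-1)) :
    Valued.v (u⁻¹ - 1) = Valued.v (u - 1) := by
  have h1 := Valued.map_eq_one_of_principal hu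
  have h0 : u ≠ 0 := by
    rw [← (Valued.v : Valuation L ℤᵐ⁰).ne_zero_iff, h1]
    simp
  rw [show u⁻¹ - 1 = -((u - 1) / u) by field_simp; ring, Valuation.map_neg, map_div₀, h1, div_one]

theorem Valued.map_zpow_sub_one_le {u : L} {c : ℤ} (hc : c ≤ -1) (hu : Valued.v (u - 1) ≤ exp c)
    (k : ℤ) : Valued.v (u ^ k - 1) ≤ exp c := by
  have hnat : ∀ k : ℕ, Valued.v (u ^ k - 1) ≤ exp c := by
    intro k
    induction k with
    | zero => simp
    | succ k ih =>
      rw [pow_succ]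
      exact Valued.map_mul_sub_one_le (by omega) ih hu
  have hc' : (exp c : ℤᵐ⁰) ≤ exp (-1) := exp_le_exp.2 hc
  obtain ⟨n, rfl | rfl⟩ := k.eq_nat_or_neg
  · rw [zpow_natCast]
    exact hnat n
  · rw [zpow_neg, zpow_natCast, Valued.map_inv_sub_one ((hnat n).trans hc')]
    exact hnat n

theorem Valued.map_pow_four_sub_one_le (h2 : Valued.v (2 : L) = exp (-2)) {u : L}
    (hu : Valued.v (u - 1) ≤ exp (-1)) : Valued.v (u ^ 4 - 1) ≤ exp (-3) := by
  have hstep : ∀ w : L, ∀ c : ℤ, -2 ≤ c → Valued.v (w - 1) ≤ exp c →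
      Valued.v (w ^ 2 - 1) ≤ exp (c + c) := by
    intro w c hc hw
    rw [show w ^ 2 - 1 = (w - 1) * -(-w - 1) by ring]
    refine Valued.map_mul_le_exp hw ?_
    rw [Valuation.map_neg]
    exact Valued.map_neg_sub_one_le h2 hc hw
  have := hstep _ _ (by norm_num) (hstep u (-1) (by norm_num) hu)
  rw [← pow_mul] at this
  exact this.trans (exp_le_exp.2 (by norm_num))

section Sqrt

variable {α : L} {m : ℤ}

theorem Valued.map_sqrt (h2 : Valued.v (2 : L) = exp (-2)) (hm : m % 8 = 7) (hα : α ^ 2 = m) :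
    Valued.v α = 1 := by
  have h := congrArg Valued.v hα
  rw [map_pow, Valued.map_int_of_odd h2 (by grind)] at h
  exact (pow_left_inj₀ zero_le zero_le two_ne_zero).1 (h.trans (one_pow 2).symm)

/-- `√m - 1` is a uniformizer, as `(√m - 1)²` is `2` times a unit. -/
theorem Valued.map_sqrt_sub_one (h2 : Valued.v (2 : L) = exp (-2)) (hm : m % 8 = 7)
    (hα : α ^ 2 = m) : Valued.v (α - 1) = exp (-1) := by
  obtain ⟨j, rfl⟩ : ∃ j, m = 8 * j + 7 := ⟨m / 8, by omega⟩
  have h1 := Valued.map_sqrt h2 hm hα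
  have h3 : Valued.v ((4 : L) * (j + 1)) < 1 := by
    have h4 : Valued.v (((j + 1 : ℤ) : L)) ≤ exp 0 := Valued.map_int_le_one _
    push_cast at h4
    have := Valued.map_mul_le_exp (Valued.map_two_pow h2 2).le h4
    rw [show (4 : L) = 2 ^ 2 by norm_num]
    refine this.trans_lt ?_
    rw [← exp_zero, exp_lt_exp]
    norm_num
  have e : (α - 1) ^ 2 = 2 * (4 * (j + 1) - α) := by
    push_cast at hα
    linear_combination hα
  have h4 : Valued.v (4 * ((j : L) + 1) - α) = 1 :=
    (Valuation.map_sub_eq_of_lt_right _ (by rwa [h1])).trans h1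
  have h5 := congrArg Valued.v e
  rw [map_pow, map_mul, h2, h4, mul_one] at h5
  refine (pow_left_inj₀ zero_le zero_le two_ne_zero).1 (h5.trans ?_)
  rw [← exp_nsmul]
  norm_num

end Sqrt

variable [CompleteSpace L] [T0Space L] {α : L} {m : ℤ}

theorem seriesLog_zpow (h2 : Valued.v (2 : L) = exp (-2)) {u : L}
    (hu : Valued.v (u - 1) ≤ exp (-1)) (k : ℤ) : seriesLog (u ^ k) = k * seriesLog u := by
  have hnat : ∀ k : ℕ, seriesLog (u ^ k) = k * seriesLog u := by
    intro k
    induction k with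
    | zero => simp
    | succ k ih =>
      have h := Valued.map_zpow_sub_one_le le_rfl hu k
      rw [zpow_natCast] at h
      rw [pow_succ, seriesLog_mul h2 h hu, ih]
      push_cast
      ring
  obtain ⟨n, rfl | rfl⟩ := k.eq_nat_or_neg
  · rw [zpow_natCast]
    exact_mod_cast hnat n
  · have h0 : u ≠ 0 := by
      rw [← (Valued.v : Valuation L ℤᵐ⁰).ne_zero_iff, Valued.map_eq_one_of_principal hu]
      simp
    have h := seriesLog_mul h2 (Valued.map_zpow_sub_one_le le_rfl hu n)
      (Valued.map_zpow_sub_one_le le_rfl hu (-n))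
    rw [← zpow_add₀ h0, add_neg_cancel, zpow_zero, seriesLog_one, zpow_natCast, hnat] at h
    push_cast
    linear_combination -h

/-- The logarithm is a local isometry. -/
theorem map_seriesLog_sub (h2 : Valued.v (2 : L) = exp (-2)) {u w : L}
    (hw : Valued.v (w - 1) ≤ exp (-1)) (huw : Valued.v (u - w) ≤ exp (-3)) :
    Valued.v (seriesLog u - seriesLog w) = Valued.v (u - w) := by
  have h1 := Valued.map_eq_one_of_principal hw
  have h0 : w ≠ 0 := by
    rw [← (Valued.v : Valuation L ℤᵐ⁰).ne_zero_iff, h1]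
    simp
  have hq : Valued.v (u / w - 1) = Valued.v (u - w) := by
    rw [div_sub_one h0, map_div₀, h1, div_one]
  have hu : u = w * (u / w) := by field_simp
  have hq3 := hq.trans_le huw
  conv_lhs => rw [hu]
  rw [seriesLog_mul h2 hw (hq3.trans (exp_le_exp.2 (by norm_num))), add_sub_cancel_left,
    map_seriesLog h2 hq3, hq]

/-- The valuation of `log u` can be read off from `2 log u = log (-u²)`. -/
theorem map_two_mul_seriesLog (h2 : Valued.v (2 : L) = exp (-2)) {u : L}
    (hu : Valued.v (u - 1) ≤ exp (-1)) (hu2 : Valued.v (-(u * u) - 1) ≤ exp (-3)) :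
    exp (-2) * Valued.v (seriesLog u) = Valued.v (-(u * u) - 1) := by
  rw [← map_seriesLog h2 hu2, seriesLog_neg h2 (Valued.map_mul_sub_one_le (by norm_num) hu hu),
    seriesLog_mul h2 hu hu, ← two_mul, map_mul, h2]


/-- `2 log √m = log (-m)` is small since `-m ≡ 1 mod 8`. -/
theorem map_seriesLog_sqrt_le (h2 : Valued.v (2 : L) = exp (-2)) (hm : m % 8 = 7)
    (hα : α ^ 2 = m) : Valued.v (seriesLog α) ≤ exp (-4) := by
  obtain ⟨j, rfl⟩ : ∃ j, m = 8 * j + 7 := ⟨m / 8, by omega⟩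
  have hle : Valued.v (-(α * α) - 1) ≤ exp (-6) := by
    have h4 : Valued.v (((-(j + 1) : ℤ) : L)) ≤ exp 0 := Valued.map_int_le_one _
    have := Valued.map_mul_le_exp (Valued.map_two_pow h2 3).le h4
    convert this using 2
    · push_cast at hα ⊢
      linear_combination -hα
    · norm_num
  have h := map_two_mul_seriesLog h2 (Valued.map_sqrt_sub_one h2 hm hα).le
    (hle.trans (exp_le_exp.2 (by norm_num)))
  rw [← h, show (-6 : ℤ) = -2 + -4 by norm_num, exp_add] at hle
  exact (mul_le_mul_iff_right₀ (by simp)).1 hle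

/-- The logarithm of a principal unit of `ℚ₂(√m)`, `m ≡ 7 mod 8`, has valuation at least `3`.
Multiplication by `-1` and `√m`, whose logarithms are `0` and small, reduces this to units
congruent to `1` modulo the cube of the maximal ideal. -/
theorem map_seriesLog_le (h2 : Valued.v (2 : L) = exp (-2))
    (hres : ∀ x : L, Valued.v x = 1 → Valued.v (x - 1) < 1) (hm : m % 8 = 7)
    (hα : α ^ 2 = m) {u : L} (hu : Valued.v (u - 1) ≤ exp (-1)) :
    Valued.v (seriesLog u) ≤ exp (-3) := by
  -- A unit with `v(w - 1) = 2` becomes closer to `1` on changing its sign.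
  have hsmall : ∀ w : L, Valued.v (w - 1) ≤ exp (-2) → Valued.v (seriesLog w) ≤ exp (-3) := by
    intro w hw
    rcases Valued.map_eq_or_le hw with h | h
    · have h3 : Valued.v (-w - 1) ≤ exp (-3) := by
        rw [show -w - 1 = -((w - 1) + 2) by ring, Valuation.map_neg]
        exact Valued.map_add_le_of_eq hres h h2
      rw [← seriesLog_neg h2 (hw.trans (exp_le_exp.2 (by norm_num))), map_seriesLog h2 h3]
      exact h3
    · rw [map_seriesLog h2 h]
      exact h
  rcases Valued.map_eq_or_le hu with h | h
  · have hα1 := Valued.map_sqrt_sub_one h2 hm hα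
    have h3 : Valued.v (u * α - 1) ≤ exp (-2) := by
      rw [show u * α - 1 = (u - 1) * (α - 1) + ((u - 1) + (α - 1)) by ring]
      exact Valuation.map_add_le _ (Valued.map_mul_le_exp h.le hα1.le)
        (Valued.map_add_le_of_eq hres h hα1)
    have e : seriesLog u = seriesLog (u * α) - seriesLog α := by
      rw [seriesLog_mul h2 hu hα1.le, add_sub_cancel_right]
    rw [e]
    exact Valuation.map_sub_le _ (hsmall _ h3)
      ((map_seriesLog_sqrt_le h2 hm hα).trans (exp_le_exp.2 (by norm_num)))
  · exact hsmall u h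

/-- For a unit `e = 4a + b√m` of norm `1` one has `-e² = 1 - 8ae`, whence `log e` has the same
valuation as `4`. -/
theorem map_seriesLog_eq (h2 : Valued.v (2 : L) = exp (-2))
    (hα : α ^ 2 = m) {a b : ℤ} (ha : Odd a) (hn : (4 * a) ^ 2 - m * b ^ 2 = 1)
    (hu : Valued.v (4 * a + b * α - 1) ≤ exp (-1)) :
    Valued.v (seriesLog (4 * a + b * α)) = exp (-4) := by
  have h1 := Valued.map_eq_one_of_principal hu
  have e : -((4 * a + b * α) * (4 * a + b * α)) - 1 = -(2 ^ 3 * a * (4 * a + b * α)) := by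
    have hn' := congrArg (Int.cast (R := L)) hn
    push_cast at hn'
    linear_combination (-(b : L) ^ 2) * hα + hn'
  have hv : Valued.v (-((4 * a + b * α) * (4 * a + b * α)) - 1) = exp (-6) := by
    rw [e, Valuation.map_neg, map_mul, map_mul, h1, Valued.map_int_of_odd h2 ha,
      Valued.map_two_pow h2, mul_one, mul_one]
    norm_num
  have h := map_two_mul_seriesLog h2 hu (hv.trans_le (exp_le_exp.2 (by norm_num)))
  rw [hv, show (-6 : ℤ) = -2 + -4 by norm_num, exp_add] at h
  exact mul_left_cancel₀ (by simp) h

end LogImage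

/-! ### Saturation of the closure of the logarithms of units -/

section Saturation

open WithZero Filter Topology

variable {L : Type*} [Field L] [Valued L ℤᵐ⁰]

/-- The closure of `ℤ y` is saturated in `{z | v z ≤ exp (-3)}` when `v y = exp (-4)`: dividing by
`2` in the closure would lead to an element of valuation `exp (-2)`. -/
theorem approx_of_natCast_mul (h2 : Valued.v (2 : L) = exp (-2)) {y z : L} {N : ℕ} (hN : N ≠ 0)
    (hy : Valued.v y = exp (-4)) (hz : Valued.v z ≤ exp (-3))
    (h : ∀ n : ℕ, ∃ k : ℤ, Valued.v (N * z - k * y) ≤ exp (-n : ℤ)) (n : ℕ) :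
    ∃ k : ℤ, Valued.v (z - k * y) ≤ exp (-n : ℤ) := by
  obtain ⟨s, q, hq, hNs, hv⟩ := Valued.exists_map_nat_eq (L := L) h2 hN
  obtain ⟨k, hk⟩ := h (n + 2 * s + 4)
  have hky : Valued.v ((k : L) * y) ≤ exp (-2 * s - 3 : ℤ) := by
    rw [show (k : L) * y = N * z - (N * z - k * y) by ring]
    refine Valuation.map_sub_le _ ?_ (hk.trans (exp_le_exp.2 (by push_cast; omega)))
    exact (Valued.map_mul_le_exp hv.le hz).trans (exp_le_exp.2 (by omega))
  have hkv : Valued.v (k : L) ≤ exp (1 - 2 * s : ℤ) := by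
    rw [map_mul, hy, show (-2 * s - 3 : ℤ) = (1 - 2 * s) + -4 by ring, exp_add] at hky
    exact (mul_le_mul_iff_left₀ (by simp)).1 hky
  obtain ⟨k', rfl⟩ := Valued.two_pow_dvd_of_le h2 hkv
  have hcop : IsCoprime (q : ℤ) ((2 : ℤ) ^ n) := by
    refine IsCoprime.pow_right ?_
    exact_mod_cast Nat.isCoprime_iff_coprime.2 (Nat.coprime_two_right.2 hq)
  obtain ⟨u, w, huw⟩ := hcop
  -- The multiplier `j = k' u` solves `q j ≡ k' mod 2 ^ n`, where `N = 2 ^ s q` and `k = 2 ^ s k'`.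
  refine ⟨k' * u, ?_⟩
  have e : (N : L) * (z - (k' * u : ℤ) * y) =
      (N * z - (2 ^ s * k' : ℤ) * y) + 2 ^ (s + n) * (k' * w : ℤ) * y := by
    have h1 := congrArg (Int.cast (R := L)) huw
    have h3 := congrArg (Nat.cast (R := L)) hNs
    push_cast at h1 h3 ⊢
    linear_combination (-(k' : L) * u * y) * h3 - (2 ^ s * k' * y : L) * h1
  have hNz : Valued.v ((N : L) * (z - (k' * u : ℤ) * y)) ≤ exp (-(2 * s) + -n : ℤ) := by
    rw [e]
    refine Valuation.map_add_le _ (hk.trans (exp_le_exp.2 (by push_cast; omega))) ?_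
    have h4 : Valued.v (((k' * w : ℤ) : L)) ≤ exp 0 := Valued.map_int_le_one _
    refine (Valued.map_mul_le_exp (Valued.map_mul_le_exp (Valued.map_two_pow h2 (s + n)).le h4)
      hy.le).trans (exp_le_exp.2 (by push_cast; omega))
  rw [map_mul, hv, exp_add] at hNz
  exact (mul_le_mul_iff_right₀ (by simp)).1 hNz

variable [CompleteSpace L] [T0Space L]

/-- Every limit of integral multiples of `log e` is the logarithm of a limit of powers of `e`. -/
theorem exists_tendsto_zpow (h2 : Valued.v (2 : L) = exp (-2)) {e z : L}
    (he : Valued.v (e - 1) ≤ exp (-1)) (hy : Valued.v (seriesLog e) = exp (-4))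
    (h : ∀ n : ℕ, ∃ k : ℤ, Valued.v (z - k * seriesLog e) ≤ exp (-n : ℤ)) :
    ∃ (k : ℕ → ℤ) (f : L), Tendsto (fun n => e ^ k n) atTop (𝓝 f) ∧
      Valued.v (f - 1) ≤ exp (-1) ∧ seriesLog f = z := by
  -- The shift by `8` makes consecutive multipliers congruent modulo `4`.
  choose k hk using fun n : ℕ => h (n + 8)
  have he1 := Valued.map_eq_one_of_principal he
  have he0 : e ≠ 0 := by
    rw [← (Valued.v : Valuation L ℤᵐ⁰).ne_zero_iff, he1]
    simp
  have hdiff : ∀ n, Valued.v (e ^ k (n + 1) - e ^ k n) ≤ exp (-n - 8 : ℤ) := by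
    intro n
    have hd : Valued.v (((k (n + 1) - k n : ℤ) : L) * seriesLog e) ≤ exp (-n - 8 : ℤ) := by
      rw [show ((k (n + 1) - k n : ℤ) : L) * seriesLog e =
        (z - k n * seriesLog e) - (z - k (n + 1) * seriesLog e) by push_cast; ring]
      exact Valuation.map_sub_le _ ((hk n).trans (exp_le_exp.2 (by push_cast; omega)))
        ((hk (n + 1)).trans (exp_le_exp.2 (by push_cast; omega)))
    have hdv : Valued.v ((k (n + 1) - k n : ℤ) : L) ≤ exp (-n - 4 : ℤ) := by
      have hd' := hd
      rw [map_mul, hy, show (-n - 8 : ℤ) = (-n - 4) + -4 by ring, exp_add] at hd'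
      exact (mul_le_mul_iff_left₀ (by simp)).1 hd'
    obtain ⟨j, hj⟩ := Valued.two_pow_dvd_of_le (s := 2) h2
      (hdv.trans (exp_le_exp.2 (by push_cast; omega)))
    -- The exponent is divisible by `4`, so that `log` is isometric at this power of `e`.
    have hd3 : Valued.v (e ^ (k (n + 1) - k n) - 1) ≤ exp (-3) := by
      rw [hj, zpow_mul, show e ^ ((2 : ℤ) ^ 2) = e ^ 4 by norm_cast]
      exact Valued.map_zpow_sub_one_le (by norm_num) (Valued.map_pow_four_sub_one_le h2 he) j
    have hmul : e ^ k (n + 1) - e ^ k n = e ^ k n * (e ^ (k (n + 1) - k n) - 1) := by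
      rw [mul_sub, ← zpow_add₀ he0, mul_one]
      congr 2
      ring
    rw [hmul, map_mul, map_zpow₀, he1, one_zpow, one_mul, ← map_seriesLog h2 hd3,
      seriesLog_zpow h2 he]
    exact hd
  have := Valued.nonarchimedeanAddGroup h2
  have hcauchy : CauchySeq fun n => e ^ k n := by
    refine NonarchimedeanAddGroup.cauchySeq_of_tendsto_sub_nhds_zero ?_
    rw [Valued.tendsto_iff_exp h2]
    intro n
    filter_upwards [eventually_ge_atTop n] with j hj
    rw [sub_zero]
    exact (hdiff j).trans (exp_le_exp.2 (by omega))
  obtain ⟨f, hf⟩ := cauchySeq_tendsto_of_complete hcauchy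
  have hf' := (Valued.tendsto_iff_exp h2).1 hf
  have hpr := fun n => Valued.map_zpow_sub_one_le le_rfl he (k n)
  refine ⟨k, f, hf, ?_, ?_⟩
  · obtain ⟨n, hn⟩ := (hf' 1).exists
    rw [show f - 1 = (e ^ k n - 1) - (e ^ k n - f) by ring]
    exact Valuation.map_sub_le _ (hpr n) hn
  · have hlog : Tendsto (fun n => seriesLog (e ^ k n)) atTop (𝓝 (seriesLog f)) := by
      rw [Valued.tendsto_iff_exp h2]
      intro n
      filter_upwards [hf' 3, hf' n] with j h3 hn
      rw [Valuation.map_sub_swap] at h3 hn ⊢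
      rw [map_seriesLog_sub h2 (hpr j) h3]
      exact hn
    refine tendsto_nhds_unique hlog ((Valued.tendsto_iff_exp h2).2 fun n => ?_)
    filter_upwards [eventually_ge_atTop n] with j hj
    rw [seriesLog_zpow h2 he, Valuation.map_sub_swap]
    exact (hk j).trans (exp_le_exp.2 (by push_cast; omega))

/-- The logarithm of a limit of the elements `± e ^ k` is a limit of integral multiples of
`log e`. -/
theorem approx_seriesLog (h2 : Valued.v (2 : L) = exp (-2)) {e u : L}
    (he : Valued.v (e - 1) ≤ exp (-1))
    (h : ∀ n : ℕ, ∃ k : ℤ, Valued.v (u - e ^ k) ≤ exp (-n : ℤ) ∨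
      Valued.v (u - -e ^ k) ≤ exp (-n : ℤ)) (n : ℕ) :
    ∃ k : ℤ, Valued.v (seriesLog u - k * seriesLog e) ≤ exp (-n : ℤ) := by
  obtain ⟨k, hk⟩ := h (n + 3)
  have hpr := Valued.map_zpow_sub_one_le le_rfl he k
  have h3 : (exp (-(n + 3 : ℕ) : ℤ) : ℤᵐ⁰) ≤ exp (-3) := exp_le_exp.2 (by push_cast; omega)
  have hn : (exp (-(n + 3 : ℕ) : ℤ) : ℤᵐ⁰) ≤ exp (-n : ℤ) := exp_le_exp.2 (by push_cast; omega)
  refine ⟨k, ?_⟩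
  rw [← seriesLog_zpow h2 he]
  rcases hk with hk | hk
  · rw [map_seriesLog_sub h2 hpr (hk.trans h3)]
    exact hk.trans hn
  · rw [← seriesLog_neg h2 hpr, map_seriesLog_sub h2
      (Valued.map_neg_sub_one_le h2 (by norm_num) hpr) (hk.trans h3)]
    exact hk.trans hn

end Saturation

/-! ### Integers and units of a real quadratic field -/

section QuadraticField

variable {K : Type*} [Field K] {α : K} {m : ℤ}

/-- The square root of `m` as an algebraic integer. -/
def sqrtInt (hα : α ^ 2 = m) : 𝓞 K :=
  ⟨α, IsIntegral.of_pow two_pos (hα ▸ isIntegral_algebraMap (x := m))⟩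

@[simp]
theorem coe_sqrtInt (hα : α ^ 2 = m) : ((sqrtInt hα : 𝓞 K) : K) = α := rfl

theorem sqrtInt_sq (hα : α ^ 2 = m) : (sqrtInt hα : 𝓞 K) ^ 2 = m := by
  ext
  simpa using hα

theorem mem_closure_neg_one_iff {ε u : (𝓞 K)ˣ} :
    u ∈ Subgroup.closure {-1, ε} ↔ ∃ k : ℤ, u = ε ^ k ∨ u = -ε ^ k := by
  rw [Subgroup.mem_closure_pair]
  constructor
  · rintro ⟨j, k, rfl⟩
    refine ⟨k, ?_⟩
    rcases Int.even_or_odd j with h | h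
    · left
      rw [h.neg_one_zpow, one_mul]
    · right
      rw [h.neg_one_zpow, neg_one_mul]
  · rintro ⟨k, rfl | rfl⟩
    · exact ⟨0, k, by simp⟩
    · exact ⟨1, k, by simp⟩

/-- The units `x + y√m` attached to the solutions `(x, y)` of the Pell equation. -/
noncomputable def pellUnit (hα : α ^ 2 = m) : Pell.Solution₁ m →* (𝓞 K)ˣ :=
  (Units.map (Zsqrtd.lift ⟨sqrtInt hα, by rw [← sq, sqrtInt_sq]⟩ : ℤ√m →+* 𝓞 K).toMonoidHom).comp
    (Unitary.toUnits (R := ℤ√m))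

theorem coe_pellUnit (hα : α ^ 2 = m) (a : Pell.Solution₁ m) :
    ((pellUnit hα a : 𝓞 K) : K) = a.x + a.y * α := by
  change ((Zsqrtd.lift ⟨sqrtInt hα, _⟩ (a : ℤ√m) : 𝓞 K) : K) = _
  simp [Zsqrtd.lift, Pell.Solution₁.x, Pell.Solution₁.y]

theorem pellUnit_neg (hα : α ^ 2 = m) (a : Pell.Solution₁ m) :
    (pellUnit hα (-a) : (𝓞 K)ˣ) = -pellUnit hα a := by
  ext
  simp only [coe_pellUnit, Pell.Solution₁.x_neg, Pell.Solution₁.y_neg, Units.val_neg, map_neg]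
  push_cast
  ring

variable [NumberField K]

theorem Squarefree.exists_intCast_eq_of_mul_sq {m : ℤ} (hm : Squarefree m) {r : ℚ} {N : ℤ}
    (h : m * r ^ 2 = N) : ∃ z : ℤ, r = z := by
  have hd : (r.den : ℚ) ≠ 0 := by exact_mod_cast r.den_ne_zero
  have h1 : m * r.num ^ 2 = N * (r.den : ℤ) ^ 2 := by
    have h2 : (m : ℚ) * r.num ^ 2 = N * (r.den : ℚ) ^ 2 := by
      rw [← h]
      nth_rw 2 [← Rat.num_div_den r]
      field_simp
    exact_mod_cast h2
  have hcop : IsCoprime ((r.den : ℤ) ^ 2) (r.num ^ 2) := by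
    refine IsCoprime.pow ?_
    rw [Int.isCoprime_iff_nat_coprime]
    simpa using r.reduced.symm
  have h3 : (r.den : ℤ) * r.den ∣ m := by
    rw [← sq]
    exact hcop.dvd_of_dvd_mul_right ⟨N, by rw [h1]; ring⟩
  have h4 : r.den = 1 := by
    have := hm _ h3
    rw [Int.isUnit_iff] at this
    omega
  exact ⟨r.num, (Rat.coe_int_num_of_den_eq_one h4).symm⟩

theorem not_isSquare_of_mod_four (hm : m % 4 = 3) : ¬ IsSquare m := by
  rintro ⟨z, rfl⟩
  rw [Int.mul_emod] at hm
  have : z % 4 = 0 ∨ z % 4 = 1 ∨ z % 4 = 2 ∨ z % 4 = 3 := by omega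
  rcases this with h | h | h | h <;> simp [h] at hm

/-- `1` and `√m` are linearly independent over `ℚ`. -/
theorem eq_zero_of_add_mul_sqrt_eq_zero (hm : m % 4 = 3) (hα : α ^ 2 = m) {p q : ℚ}
    (h : (p : K) + q * α = 0) : p = 0 ∧ q = 0 := by
  have hq : q = 0 := by
    by_contra hq
    have hqK : (q : K) ≠ 0 := by exact_mod_cast hq
    have h1 : (p : K) ^ 2 = m * q ^ 2 := by
      rw [← hα]
      linear_combination (p - q * α) * h
    have h2 : p ^ 2 = m * q ^ 2 := by exact_mod_cast h1
    refine not_isSquare_of_mod_four hm (Rat.isSquare_intCast_iff.1 ⟨p / q, ?_⟩)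
    field_simp
    linarith
  subst hq
  simpa using h

theorem add_mul_sqrt_injective (hm : m % 4 = 3) (hα : α ^ 2 = m) {a b c d : ℤ}
    (h : (a : K) + b * α = c + d * α) : a = c ∧ b = d := by
  have h1 := eq_zero_of_add_mul_sqrt_eq_zero hm hα (p := (a - c : ℤ)) (q := (b - d : ℤ)) (by
    push_cast
    linear_combination h)
  have h2 := h1.1
  have h3 := h1.2
  norm_cast at h2 h3
  omega

theorem exists_eq_add_mul_sqrt (hα : α ^ 2 = m) (hK : IntermediateField.adjoin ℚ {α} = ⊤) (x : K) :
    ∃ p q : ℚ, x = p + q * α := by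
  have hint : IsIntegral ℚ α := Algebra.IsIntegral.isIntegral α
  have hx : x ∈ Algebra.adjoin ℚ {α} := by
    rw [← IntermediateField.adjoin_simple_toSubalgebra_of_isAlgebraic hint.isAlgebraic, hK]
    trivial
  induction hx using Algebra.adjoin_induction with
  | mem x hx =>
    rw [Set.mem_singleton_iff.1 hx]
    exact ⟨0, 1, by simp⟩
  | algebraMap r => exact ⟨r, 0, by simp⟩
  | add x y _ _ hx hy =>
    obtain ⟨p, q, rfl⟩ := hx
    obtain ⟨p', q', rfl⟩ := hy
    exact ⟨p + p', q + q', by push_cast; ring⟩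
  | mul x y _ _ hx hy =>
    obtain ⟨p, q, rfl⟩ := hx
    obtain ⟨p', q', rfl⟩ := hy
    exact ⟨p * p' + m * q * q', p * q' + q * p', by
      push_cast
      linear_combination (q * q' : K) * hα⟩

open Polynomial in
/-- The trace and norm of an integral element of a quadratic field are integers. -/
theorem exists_intCast_eq_of_isIntegral (hm : m % 4 = 3) (hα : α ^ 2 = m) {p q : ℚ} (hq : q ≠ 0)
    (h : IsIntegral ℤ ((p : K) + q * α)) : ∃ A N : ℤ, 2 * p = A ∧ p ^ 2 - m * q ^ 2 = N := by
  set x : K := p + q * α with hx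
  set P : ℚ[X] := X ^ 2 + C (-2 * p) * X + C (p ^ 2 - m * q ^ 2) with hP
  have hdeg : P.natDegree = 2 := by
    rw [hP]
    compute_degree!
  have hPm : P.Monic := by
    rw [hP]
    monicity!
  have hroot : aeval x P = 0 := by
    rw [hP, hx]
    simp only [map_add, map_mul, aeval_X, aeval_C, map_pow, eq_ratCast]
    push_cast
    linear_combination (q : K) ^ 2 * hα
  have hint : IsIntegral ℚ x := h.tower_top
  have h2 : 2 ≤ (minpoly ℚ x).natDegree := by
    rw [minpoly.two_le_natDegree_iff hint]
    rintro ⟨r, hr⟩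
    refine hq (eq_zero_of_add_mul_sqrt_eq_zero hm hα (p := p - r) (q := q) ?_).2
    rw [eq_ratCast] at hr
    push_cast
    rw [hr, hx]
    ring
  have hmin : P = minpoly ℚ x := eq_of_monic_of_dvd_of_natDegree_le (minpoly.monic hint) hPm
    (minpoly.dvd _ _ hroot) (hdeg.trans_le h2)
  have hZ := minpoly.isIntegrallyClosed_eq_field_fractions' ℚ h
  rw [← hmin] at hZ
  have hcoeff : ∀ t d : ℚ, (X ^ 2 + C t * X + C d).coeff 0 = d ∧
      (X ^ 2 + C t * X + C d).coeff 1 = t := fun t d => by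
    simp [coeff_X, coeff_C]
  have h0 := congrArg (fun R => R.coeff 0) hZ
  have h1 := congrArg (fun R => R.coeff 1) hZ
  simp only [hP, coeff_map, (hcoeff _ _).1, (hcoeff _ _).2, eq_intCast] at h0 h1
  refine ⟨-(minpoly ℤ x).coeff 1, (minpoly ℤ x).coeff 0, ?_, h0⟩
  push_cast
  linarith

/-- The ring of integers of `ℚ(√m)` is `ℤ[√m]` for squarefree `m ≡ 3 mod 4`. -/
theorem exists_int_eq_add_mul_sqrt (hm : m % 4 = 3) (hsq : Squarefree m) (hα : α ^ 2 = m)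
    (hK : IntermediateField.adjoin ℚ {α} = ⊤) (x : 𝓞 K) :
    ∃ a b : ℤ, (x : K) = a + b * α := by
  obtain ⟨p, q, hx⟩ := exists_eq_add_mul_sqrt hα hK (x : K)
  have hint : IsIntegral ℤ ((p : K) + q * α) := hx ▸ RingOfIntegers.isIntegral_coe x
  rcases eq_or_ne q 0 with rfl | hq
  · have h1 : IsIntegral ℤ (algebraMap ℚ K p) := by simpa using hint
    rw [isIntegral_algebraMap_iff (algebraMap ℚ K).injective] at h1
    obtain ⟨z, hz⟩ := IsIntegrallyClosed.isIntegral_iff.1 h1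
    exact ⟨z, 0, by rw [hx, ← hz]; simp⟩
  · obtain ⟨A, N, hA, hN⟩ := exists_intCast_eq_of_isIntegral hm hα hq hint
    obtain ⟨B, hB⟩ := hsq.exists_intCast_eq_of_mul_sq (r := 2 * q) (N := A ^ 2 - 4 * N) (by
      push_cast
      rw [← hA, ← hN]
      ring)
    have h4 : A ^ 2 - m * B ^ 2 = 4 * N := by
      have : (A : ℚ) ^ 2 - m * B ^ 2 = 4 * N := by
        rw [← hA, ← hB, ← hN]
        ring
      exact_mod_cast this
    -- Modulo `4` the equation reads `A² + B² ≡ 0`.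
    have hAB : Even A ∧ Even B := by
      obtain ⟨j, hj⟩ : ∃ j, m = 4 * j + 3 := ⟨m / 4, by omega⟩
      rw [hj] at h4
      rcases Int.even_or_odd' A with ⟨s, rfl | rfl⟩ <;>
        rcases Int.even_or_odd' B with ⟨t, rfl | rfl⟩
      · exact ⟨by simp, by simp⟩
      all_goals
        exfalso
        ring_nf at h4
        omega
    obtain ⟨⟨a, rfl⟩, ⟨b, rfl⟩⟩ := hAB
    refine ⟨a, b, ?_⟩
    have hp : p = a := by push_cast at hA; linarith
    have hq' : q = b := by push_cast at hB; linarith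
    rw [hx, hp, hq']
    simp

theorem pellUnit_injective (hm : m % 4 = 3) (hα : α ^ 2 = m) :
    Function.Injective (pellUnit hα : Pell.Solution₁ m →* (𝓞 K)ˣ) := by
  intro a b h
  have h1 : ((pellUnit hα a : 𝓞 K) : K) = (pellUnit hα b : 𝓞 K) := by rw [h]
  rw [coe_pellUnit, coe_pellUnit] at h1
  obtain ⟨h2, h3⟩ := add_mul_sqrt_injective hm hα h1
  exact Pell.Solution₁.ext h2 h3

/-- All units come from the Pell equation, since `-1` is not a norm. -/
theorem pellUnit_surjective (hm : m % 4 = 3) (hsq : Squarefree m) (hα : α ^ 2 = m)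
    (hK : IntermediateField.adjoin ℚ {α} = ⊤) :
    Function.Surjective (pellUnit hα : Pell.Solution₁ m →* (𝓞 K)ˣ) := by
  intro u
  obtain ⟨a, b, hab⟩ := exists_int_eq_add_mul_sqrt hm hsq hα hK (u : 𝓞 K)
  obtain ⟨c, d, hcd⟩ := exists_int_eq_add_mul_sqrt hm hsq hα hK ((u⁻¹ : (𝓞 K)ˣ) : 𝓞 K)
  have h1 : ((u : 𝓞 K) : K) * ((u⁻¹ : (𝓞 K)ˣ) : 𝓞 K) = 1 := by
    rw [← map_mul, Units.mul_inv, map_one]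
  rw [hab, hcd] at h1
  obtain ⟨h2, h3⟩ := add_mul_sqrt_injective hm hα (a := a * c + m * b * d) (b := a * d + b * c)
    (c := 1) (d := 0) (by
      push_cast
      linear_combination h1 - (b * d : K) * hα)
  have hnorm : (a ^ 2 - m * b ^ 2) * (c ^ 2 - m * d ^ 2) = 1 := by
    linear_combination (a * c + m * b * d + 1) * h2 - m * (a * d + b * c) * h3
  have ha : a ^ 2 - m * b ^ 2 = 1 := by
    refine (Int.isUnit_iff.1 (IsUnit.of_mul_eq_one _ hnorm)).resolve_right fun h => ?_
    -- Norms `a² - m b² ≡ a² + b²` are never `-1` modulo `4`.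
    obtain ⟨j, hj⟩ : ∃ j, m = 4 * j + 3 := ⟨m / 4, by omega⟩
    rw [hj] at h
    rcases Int.even_or_odd' a with ⟨s, rfl | rfl⟩ <;> rcases Int.even_or_odd' b with ⟨t, rfl | rfl⟩
    all_goals
      ring_nf at h
      omega
  refine ⟨Pell.Solution₁.mk a b ha, ?_⟩
  ext
  rw [coe_pellUnit, hab, Pell.Solution₁.x_mk, Pell.Solution₁.y_mk]

theorem exists_zpow_of_closure_eq_top (hm : m % 4 = 3) (hα : α ^ 2 = m) {a : Pell.Solution₁ m}
    (h : Subgroup.closure {-1, (pellUnit hα a : (𝓞 K)ˣ)} = ⊤) (b : Pell.Solution₁ m) :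
    ∃ k : ℤ, b = a ^ k ∨ b = -a ^ k := by
  obtain ⟨k, hk⟩ := mem_closure_neg_one_iff.1 (h ▸ Subgroup.mem_top (pellUnit hα b))
  refine ⟨k, hk.imp (fun hk => ?_) fun hk => ?_⟩ <;> apply pellUnit_injective hm hα
  · rw [hk, map_zpow]
  · rw [hk, pellUnit_neg, map_zpow]

/-- The fundamental solution of the Pell equation is a fundamental unit. -/
theorem closure_eq_top_of_isFundamental (hm : m % 4 = 3) (hsq : Squarefree m) (hα : α ^ 2 = m)
    (hK : IntermediateField.adjoin ℚ {α} = ⊤) {f : Pell.Solution₁ m} (hf : Pell.IsFundamental f) :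
    Subgroup.closure {-1, (pellUnit hα f : (𝓞 K)ˣ)} = ⊤ := by
  rw [eq_top_iff]
  intro u _
  obtain ⟨b, rfl⟩ := pellUnit_surjective hm hsq hα hK u
  obtain ⟨k, hk⟩ := hf.eq_zpow_or_neg_zpow b
  refine mem_closure_neg_one_iff.2 ⟨k, hk.imp (fun hk => ?_) fun hk => ?_⟩
  · rw [hk, map_zpow]
  · rw [hk, pellUnit_neg, map_zpow]

end QuadraticField

namespace IsDengLi

variable {n : ℕ} {ℓ : ℕ → ℕ}

theorem squarefree (hℓ : IsDengLi n ℓ) : Squarefree ((∏ i ∈ Finset.Icc 1 n, ℓ i : ℕ) : ℤ) := by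
  rw [Int.squarefree_natCast]
  have hp : ∀ i ∈ Finset.Icc 1 n, (ℓ i).Prime := fun i hi => hℓ.prime i (by grind) (by grind)
  refine Finset.squarefree_prod_of_pairwise_isCoprime (fun i hi j hj hij => ?_)
    fun i hi => (hp i hi).squarefree
  exact Nat.coprime_iff_isRelPrime.1 ((Nat.coprime_primes (hp i hi) (hp j hj)).2
    fun e => hij (hℓ.injOn hi hj e))

/-- The shape of the fundamental units of `ℚ(√m)`. -/
theorem exists_fundamentalUnit_eq (hℓ : IsDengLi n ℓ) {K : Type*} [Field K] [NumberField K] {α : K}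
    (hα : α ^ 2 = ((∏ i ∈ Finset.Icc 1 n, ℓ i : ℕ) : ℤ))
    (hK : IntermediateField.adjoin ℚ {α} = ⊤) {ε : (𝓞 K)ˣ}
    (hε : Subgroup.closure {-1, ε} = ⊤) :
    ∃ a b : ℤ, Odd a ∧ Odd b ∧ ((ε : 𝓞 K) : K) = 4 * a + b * α ∧
      (4 * a) ^ 2 - ((∏ i ∈ Finset.Icc 1 n, ℓ i : ℕ) : ℤ) * b ^ 2 = 1 := by
  have hm := hℓ.prod_Icc_mod_eight
  have hm4 : ((∏ i ∈ Finset.Icc 1 n, ℓ i : ℕ) : ℤ) % 4 = 3 := by omega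
  obtain ⟨s, rfl⟩ := pellUnit_surjective hm4 hℓ.squarefree hα hK ε
  have hs := hℓ.fundamental_mod_eight (exists_zpow_of_closure_eq_top hm4 hα hε)
  obtain ⟨a, ha, hsa⟩ : ∃ a, Odd a ∧ s.x = 4 * a := ⟨s.x / 4, by
    rw [Int.odd_iff]
    omega, by omega⟩
  have hprop := s.prop
  refine ⟨a, s.y, ha, ?_, ?_, by rw [← hsa, hprop]⟩
  · by_contra hy
    obtain ⟨t, ht⟩ := Int.not_odd_iff_even.1 hy
    rw [hsa, ht] at hprop
    ring_nf at hprop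
    omega
  · rw [coe_pellUnit, hsa]
    push_cast
    ring

end IsDengLi

/-! ### The place above two -/

section Place

open WithZero

variable {K : Type*} [Field K] [NumberField K] {α : K} {m : ℤ}

theorem odd_notMem (v : PlacesAbove K 2) {k : ℤ} (hk : Odd k) : (k : 𝓞 K) ∉ v.1.asIdeal := by
  intro h
  obtain ⟨j, rfl⟩ := hk
  refine v.1.isPrime.ne_top ((Ideal.eq_top_iff_one _).2 ?_)
  have h2 : (2 : 𝓞 K) ∈ v.1.asIdeal := by exact_mod_cast v.2
  have := v.1.asIdeal.sub_mem h (v.1.asIdeal.mul_mem_right (j : 𝓞 K) h2)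
  push_cast at this
  rwa [add_sub_cancel_left] at this

/-- `(1 + √m)²` is `2` times an element of the order `ℤ[√m]`, for `m` odd. -/
theorem one_add_sqrtInt_mem (hm : m % 8 = 7) (hα : α ^ 2 = m) (v : PlacesAbove K 2) :
    1 + sqrtInt hα ∈ v.1.asIdeal := by
  obtain ⟨j, hj⟩ : ∃ j, m = 8 * j + 7 := ⟨m / 8, by omega⟩
  have h2 : (2 : 𝓞 K) ∈ v.1.asIdeal := by exact_mod_cast v.2
  have e : (1 + sqrtInt hα) ^ 2 = 2 * (((4 * j + 4 : ℤ) : 𝓞 K) + sqrtInt hα) := by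
    have h := (sqrtInt_sq hα).trans (congrArg (Int.cast (R := 𝓞 K)) hj)
    push_cast at h ⊢
    linear_combination h
  have : (1 + sqrtInt hα) ^ 2 ∈ v.1.asIdeal := e ▸ v.1.asIdeal.mul_mem_right _ h2
  exact v.1.isPrime.mem_of_pow_mem 2 this

/-- The primes above `2` consist of the `a + b√m` with `a ≡ b mod 2`; so there is only one. -/
theorem mem_asIdeal_iff (hm : m % 8 = 7) (hα : α ^ 2 = m) (v : PlacesAbove K 2) (a b : ℤ) :
    (a : 𝓞 K) + b * sqrtInt hα ∈ v.1.asIdeal ↔ Even (a - b) := by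
  have hπ := v.1.asIdeal.mul_mem_left (b : 𝓞 K) (one_add_sqrtInt_mem hm hα v)
  have h2 : (2 : 𝓞 K) ∈ v.1.asIdeal := by exact_mod_cast v.2
  have e : (a : 𝓞 K) + b * sqrtInt hα = ((a - b : ℤ) : 𝓞 K) + b * (1 + sqrtInt hα) := by
    push_cast
    ring
  rw [e, v.1.asIdeal.add_mem_iff_left hπ]
  constructor
  · intro h
    by_contra hodd
    exact odd_notMem v (Int.not_even_iff_odd.1 hodd) h
  · rintro ⟨c, hc⟩
    rw [hc, ← two_mul]
    push_cast
    exact v.1.asIdeal.mul_mem_right _ h2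

theorem exists_int_eq_add_mul_sqrtInt (hm : m % 8 = 7) (hsq : Squarefree m) (hα : α ^ 2 = m)
    (hK : IntermediateField.adjoin ℚ {α} = ⊤) (x : 𝓞 K) :
    ∃ a b : ℤ, x = a + b * sqrtInt hα := by
  obtain ⟨a, b, h⟩ := exists_int_eq_add_mul_sqrt (by omega) hsq hα hK x
  exact ⟨a, b, by ext; simpa using h⟩

theorem subsingleton_placesAbove_two (hm : m % 8 = 7) (hsq : Squarefree m) (hα : α ^ 2 = m)
    (hK : IntermediateField.adjoin ℚ {α} = ⊤) :
    Subsingleton (PlacesAbove K 2) := by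
  refine ⟨fun v w => Subtype.ext (HeightOneSpectrum.ext ?_)⟩
  ext x
  obtain ⟨a, b, rfl⟩ := exists_int_eq_add_mul_sqrtInt hm hsq hα hK x
  rw [mem_asIdeal_iff hm hα, mem_asIdeal_iff hm hα]

theorem valued_coe_integer (v : HeightOneSpectrum (𝓞 K)) (x : 𝓞 K) :
    Valued.v (algebraMap K (v.adicCompletion K) x) = v.intValuation x := by
  rw [← v.valuation_of_algebraMap (K := K)]
  exact v.valuedAdicCompletion_eq_valuation' (x : K)

/-- The prime `2` is ramified, with uniformizer `1 + √m`. -/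
theorem valued_two (hm : m % 8 = 7) (hsq : Squarefree m) (hα : α ^ 2 = m)
    (hK : IntermediateField.adjoin ℚ {α} = ⊤) (v : PlacesAbove K 2) :
    Valued.v (2 : v.1.adicCompletion K) = exp (-2) := by
  obtain ⟨j, hj⟩ : ∃ j, m = 8 * j + 7 := ⟨m / 8, by omega⟩
  have h2 : Valued.v (2 : v.1.adicCompletion K) = v.1.intValuation 2 := by
    rw [← valued_coe_integer, show (((2 : 𝓞 K) : K)) = 2 from map_ofNat _ 2,
      map_ofNat (algebraMap K (v.1.adicCompletion K))]
  have hunit : v.1.intValuation (((4 * j + 4 : ℤ) : 𝓞 K) + sqrtInt hα) = 1 := by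
    rw [HeightOneSpectrum.intValuation_eq_one_iff]
    have := mem_asIdeal_iff hm hα v (4 * j + 4) 1
    rw [Int.cast_one, one_mul] at this
    rw [this]
    grind
  have e : (1 + sqrtInt hα) ^ 2 = 2 * (((4 * j + 4 : ℤ) : 𝓞 K) + sqrtInt hα) := by
    have h := (sqrtInt_sq hα).trans (congrArg (Int.cast (R := 𝓞 K)) hj)
    push_cast at h ⊢
    linear_combination h
  have he := congrArg v.1.intValuation e
  rw [map_pow, map_mul, hunit, mul_one] at he
  have hlt : v.1.intValuation (1 + sqrtInt hα) < 1 :=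
    (v.1.intValuation_lt_one_iff_mem _).2 (one_add_sqrtInt_mem hm hα v)
  -- A uniformizer `a + b√m` is a combination of `2` and `1 + √m`, so `1 + √m` is
  -- one as well.
  obtain ⟨ϖ, hϖ⟩ := v.1.intValuation_exists_uniformizer
  have hmem : ϖ ∈ v.1.asIdeal := by
    rw [← v.1.intValuation_lt_one_iff_mem, hϖ, ← exp_zero, exp_lt_exp]
    norm_num
  obtain ⟨a, b, rfl⟩ := exists_int_eq_add_mul_sqrtInt hm hsq hα hK ϖ
  obtain ⟨c, hc⟩ := (mem_asIdeal_iff hm hα v a b).1 hmem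
  have hge : exp (-1) ≤ v.1.intValuation (1 + sqrtInt hα) := by
    rw [← hϖ, show (a : 𝓞 K) + b * sqrtInt hα = 2 * (c : 𝓞 K) + b * (1 + sqrtInt hα) by
      have := congrArg (Int.cast (R := 𝓞 K)) hc
      push_cast at this
      linear_combination this]
    refine Valuation.map_add_le _ ?_ ?_ <;> rw [map_mul]
    · rw [← he, sq, mul_assoc]
      exact mul_le_of_le_one_right' (mul_le_one' hlt.le (v.1.intValuation_le_one _))
    · exact mul_le_of_le_one_left' (v.1.intValuation_le_one _)
  have hle : v.1.intValuation (1 + sqrtInt hα) ≤ exp (-1) := by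
    rw [← lt_mul_exp_iff_le (by simp), ← exp_add]
    simpa using hlt
  rw [h2, ← he, le_antisymm hle hge, ← exp_nsmul]
  norm_num

/-- The residue field of the place above `2` has two elements. -/
theorem valued_sub_one_lt (hm : m % 8 = 7) (hsq : Squarefree m) (hα : α ^ 2 = m)
    (hK : IntermediateField.adjoin ℚ {α} = ⊤) (v : PlacesAbove K 2) (x : v.1.adicCompletion K)
    (hx : Valued.v x = 1) : Valued.v (x - 1) < 1 := by
  have h2 := valued_two hm hsq hα hK v
  -- Approximate `x` by `k ∈ K`, then by an algebraic integer `a`.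
  obtain ⟨k, hk⟩ := (v.1.denseRange_algebraMap (K := K)).exists_mem_open
    (isOpen_interior (s := {y : v.1.adicCompletion K | Valued.v (y - x) ≤ exp (-1)}))
    ⟨x, mem_interior_iff_mem_nhds.2 ((Valued.mem_nhds_iff_exp h2).2 ⟨1, subset_rfl⟩)⟩
  have hkx : Valued.v (algebraMap K (v.1.adicCompletion K) k - x) < 1 :=
    Valued.le_exp_neg_one.1
      (show algebraMap K (v.1.adicCompletion K) k ∈ {y | Valued.v (y - x) ≤ exp (-1)} from
        interior_subset hk)
  have hk1 : v.1.valuation K k ≤ 1 := by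
    have h := Valuation.map_add_le _ hkx.le hx.le
    rw [sub_add_cancel] at h
    exact (v.1.valuedAdicCompletion_eq_valuation' k).symm.trans_le h
  obtain ⟨a, ha⟩ := v.1.exists_valuation_sub_lt_of_integer hk1 1
  have hak : Valued.v (algebraMap K (v.1.adicCompletion K) (a : K) -
      algebraMap K (v.1.adicCompletion K) k) < 1 := by
    rw [← map_sub]
    exact (v.1.valuedAdicCompletion_eq_valuation' _).trans_lt ha
  have hax := Valuation.map_add_lt _ hak hkx
  rw [sub_add_sub_cancel] at hax
  have ha1 : v.1.intValuation a = 1 := by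
    rw [← valued_coe_integer, ← hx]
    exact Valuation.map_eq_of_sub_lt _ (by rwa [hx])
  have hmem : a - 1 ∈ v.1.asIdeal := by
    rw [HeightOneSpectrum.intValuation_eq_one_iff] at ha1
    obtain ⟨c, d, rfl⟩ := exists_int_eq_add_mul_sqrtInt hm hsq hα hK a
    rw [mem_asIdeal_iff hm hα] at ha1
    have := mem_asIdeal_iff hm hα v (c - 1) d
    push_cast at this
    rw [add_sub_right_comm, this]
    grind
  rw [← v.1.intValuation_lt_one_iff_mem, ← valued_coe_integer,
    show ((a - 1 : 𝓞 K) : K) = a - 1 from map_sub _ _ _, map_sub, map_one] at hmem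
  have := Valuation.map_sub_lt _ hmem hax
  rwa [show ∀ s t : v.1.adicCompletion K, s - 1 - (s - t) = t - 1 by intros; ring] at this

end Place

/-! ### The normalized regulator -/

section Regulator

open WithZero Filter Topology

variable {K : Type*} [Field K] [NumberField K]

theorem localLog_apply (u : (CompletionsAbove K 2)ˣ) (v : PlacesAbove K 2) :
    localLog K 2 u v = seriesLog ((u : CompletionsAbove K 2) v) := rfl

theorem unitsDiagonal_apply (p : ℕ) (u : (𝓞 K)ˣ) (v : PlacesAbove K p) :
    (unitsDiagonal K p u : CompletionsAbove K p) v =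
      algebraMap K (v.1.adicCompletion K) (u : 𝓞 K) := rfl

theorem unitsDiagonal_zpow_apply (p : ℕ) (u : (𝓞 K)ˣ) (k : ℤ) (v : PlacesAbove K p) :
    (unitsDiagonal K p (u ^ k) : CompletionsAbove K p) v =
      (unitsDiagonal K p u : CompletionsAbove K p) v ^ k := by
  let g : (𝓞 K)ˣ →* (v.1.adicCompletion K)ˣ :=
    Units.map ((algebraMap K (v.1.adicCompletion K)).comp (algebraMap (𝓞 K) K)).toMonoidHom
  change ((g (u ^ k) : (v.1.adicCompletion K)ˣ) : v.1.adicCompletion K) = (g u : _) ^ k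
  rw [map_zpow, Units.val_zpow_eq_zpow_val]

theorem unitsDiagonal_neg_apply (p : ℕ) (u : (𝓞 K)ˣ) (v : PlacesAbove K p) :
    (unitsDiagonal K p (-u) : CompletionsAbove K p) v =
      -(unitsDiagonal K p u : CompletionsAbove K p) v := by
  simp [unitsDiagonal_apply]

/-- If every unit at the places above `2` is congruent to `1`, all global units are principal. -/
theorem unitsDiagonal_mem_principalLocalUnits
    (hres : ∀ (v : PlacesAbove K 2) (x : v.1.adicCompletion K),
      Valued.v x = 1 → Valued.v (x - 1) < 1) (u : (𝓞 K)ˣ) :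
    unitsDiagonal K 2 u ∈ principalLocalUnits K 2 := by
  intro v
  refine hres v _ ?_
  rw [unitsDiagonal_apply, valued_coe_integer, HeightOneSpectrum.intValuation_eq_one_iff]
  exact fun h => v.1.isPrime.ne_top (Ideal.eq_top_of_isUnit_mem _ h u.isUnit)

/-- Elements of the closure of the units are approximated by units at any one place. -/
theorem exists_approx_of_mem_closureOfUnits
    (h2 : ∀ v : PlacesAbove K 2, Valued.v (2 : v.1.adicCompletion K) = exp (-2))
    {u : (CompletionsAbove K 2)ˣ} (hu : u ∈ closureOfUnits K 2) (v : PlacesAbove K 2) (n : ℕ) :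
    ∃ η : (𝓞 K)ˣ, unitsDiagonal K 2 η ∈ principalLocalUnits K 2 ∧
      Valued.v ((u : CompletionsAbove K 2) v - (unitsDiagonal K 2 η : CompletionsAbove K 2) v) ≤
        exp (-n : ℤ) := by
  have hcont : Continuous fun w : (CompletionsAbove K 2)ˣ => (w : CompletionsAbove K 2) v :=
    (continuous_apply v).comp Units.continuous_val
  have hnhds := hcont.continuousAt (x := u) ((Valued.mem_nhds_iff_exp (h2 v)).2 ⟨n, subset_rfl⟩)
  obtain ⟨w, hw, ⟨η, rfl⟩, hp⟩ := mem_closure_iff_nhds.1 hu _ hnhds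
  refine ⟨η, hp, ?_⟩
  rw [Valuation.map_sub_swap]
  exact hw

/-- If `2` has a single prime divisor, which is ramified with residue field `𝔽₂`, the logarithms
of principal units have valuation at least `3`, and the logarithm of the fundamental unit has
valuation exactly `4`, then the normalized `2`-adic regulator is trivial. -/
theorem subsingleton_normalizedRegulator [Subsingleton (PlacesAbove K 2)]
    (h2 : ∀ v : PlacesAbove K 2, Valued.v (2 : v.1.adicCompletion K) = exp (-2))
    (hres : ∀ (v : PlacesAbove K 2) (x : v.1.adicCompletion K),
      Valued.v x = 1 → Valued.v (x - 1) < 1)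
    (hlog : ∀ (v : PlacesAbove K 2) (x : v.1.adicCompletion K),
      Valued.v (x - 1) ≤ exp (-1) → Valued.v (seriesLog x) ≤ exp (-3))
    {ε : (𝓞 K)ˣ} (hε : Subgroup.closure {-1, ε} = ⊤)
    (hεlog : ∀ v : PlacesAbove K 2,
      Valued.v (localLog K 2 (unitsDiagonal K 2 ε) v) = exp (-4)) :
    Subsingleton (NormalizedRegulator K 2) := by
  have hprinc : ∀ (u : (𝓞 K)ˣ) (v : PlacesAbove K 2),
      Valued.v ((unitsDiagonal K 2 u : CompletionsAbove K 2) v - 1) ≤ exp (-1) := fun u v =>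
    Valued.le_exp_neg_one.2 (unitsDiagonal_mem_principalLocalUnits hres u v)
  have hU : ∀ z ∈ logImage K 2 (principalLocalUnits K 2), ∀ v, Valued.v (z v) ≤ exp (-3) := by
    intro z hz v
    induction hz using AddSubgroup.closure_induction with
    | mem z hz =>
      obtain ⟨u, hu, rfl⟩ := hz
      exact hlog v _ (Valued.le_exp_neg_one.2 (hu v))
    | zero => simp
    | add a b _ _ ha hb => exact Valuation.map_add_le _ ha hb
    | neg a _ ha =>
      rw [Pi.neg_apply, Valuation.map_neg]
      exact ha
  have hE : ∀ z ∈ logImage K 2 (closureOfUnits K 2), ∀ v, ∀ n : ℕ, ∃ k : ℤ,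
      Valued.v (z v - k * localLog K 2 (unitsDiagonal K 2 ε) v) ≤ exp (-n : ℤ) := by
    intro z hz v n
    induction hz using AddSubgroup.closure_induction with
    | mem z hz =>
      obtain ⟨u, hu, rfl⟩ := hz
      refine approx_seriesLog (h2 v) (hprinc ε v) (fun j => ?_) n
      obtain ⟨η, -, hη⟩ := exists_approx_of_mem_closureOfUnits h2 hu v j
      obtain ⟨k, hk⟩ := mem_closure_neg_one_iff.1 (hε ▸ Subgroup.mem_top η)
      refine ⟨k, hk.imp (fun hk => ?_) fun hk => ?_⟩
      · rwa [hk, unitsDiagonal_zpow_apply] at hη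
      · rwa [hk, unitsDiagonal_neg_apply, unitsDiagonal_zpow_apply] at hη
    | zero => exact ⟨0, by simp⟩
    | add a b _ _ ha hb =>
      obtain ⟨k, hk⟩ := ha
      obtain ⟨j, hj⟩ := hb
      refine ⟨k + j, ?_⟩
      have := Valuation.map_add_le _ hk hj
      convert this using 2
      rw [Pi.add_apply]
      push_cast
      ring
    | neg a _ ha =>
      obtain ⟨k, hk⟩ := ha
      refine ⟨-k, ?_⟩
      rw [← Valuation.map_neg] at hk
      convert hk using 2
      rw [Pi.neg_apply]
      push_cast
      ring
  have hE' : ∀ z : CompletionsAbove K 2, (∀ v, ∀ n : ℕ, ∃ k : ℤ,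
      Valued.v (z v - k * localLog K 2 (unitsDiagonal K 2 ε) v) ≤ exp (-n : ℤ)) →
      z ∈ logImage K 2 (closureOfUnits K 2) := by
    intro z hz
    -- The exponents come from the unique place; quantifying over all places `v` afterwards avoids
    -- transport along equalities of places.
    have hlim : ∃ k : ℕ → ℤ, ∀ v, ∃ f : v.1.adicCompletion K,
        Tendsto (fun n => (unitsDiagonal K 2 ε : CompletionsAbove K 2) v ^ k n) atTop (𝓝 f) ∧
        Valued.v (f - 1) ≤ exp (-1) ∧ seriesLog f = z v := by
      rcases isEmpty_or_nonempty (PlacesAbove K 2) with hempty | ⟨⟨v⟩⟩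
      · exact ⟨0, fun v => hempty.elim v⟩
      · obtain ⟨k, hk⟩ := exists_tendsto_zpow (h2 v) (hprinc ε v) (hεlog v) (hz v)
        refine ⟨k, fun w => ?_⟩
        obtain rfl := Subsingleton.elim v w
        exact hk
    obtain ⟨k, hk⟩ := hlim
    choose f hf hf1 hfz using hk
    have hf0 : ∀ v, f v ≠ 0 := fun v => by
      rw [← (Valued.v : Valuation (v.1.adicCompletion K) ℤᵐ⁰).ne_zero_iff,
        Valued.map_eq_one_of_principal (hf1 v)]
      simp
    let F : (CompletionsAbove K 2)ˣ := MulEquiv.piUnits.symm fun v => Units.mk0 (f v) (hf0 v)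
    have hFt : Tendsto (fun n => unitsDiagonal K 2 (ε ^ k n)) atTop (𝓝 F) := by
      rw [Units.isInducing_embedProduct.tendsto_nhds_iff]
      refine Tendsto.prodMk_nhds ?_ ?_
      · refine tendsto_pi_nhds.2 fun v => ?_
        exact (hf v).congr fun n => (unitsDiagonal_zpow_apply 2 ε (k n) v).symm
      -- The topology of the unit group also requires the inverses to converge.
      · refine (MulOpposite.continuous_op.tendsto _).comp (tendsto_pi_nhds.2 fun v => ?_)
        have := (hf v).inv₀ (hf0 v)
        refine this.congr fun n => ?_
        rw [← zpow_neg, ← unitsDiagonal_zpow_apply, ← map_inv, zpow_neg]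
    refine AddSubgroup.subset_closure ⟨F, ?_, funext fun v => hfz v⟩
    exact mem_closure_of_tendsto hFt (Eventually.of_forall fun n =>
      ⟨⟨_, rfl⟩, unitsDiagonal_mem_principalLocalUnits hres _⟩)
  refine ⟨fun a b => ?_⟩
  suffices h : ∀ a : NormalizedRegulator K 2, a = 0 by rw [h a, h b]
  rintro ⟨q, hq⟩
  obtain ⟨N, hN, hNq⟩ := isOfFinAddOrder_iff_nsmul_eq_zero.1 hq
  ext
  induction q using QuotientAddGroup.induction_on with
  | H z =>
    rw [← QuotientAddGroup.mk_nsmul, QuotientAddGroup.eq_zero_iff,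
      AddSubgroup.mem_addSubgroupOf] at hNq
    refine (QuotientAddGroup.eq_zero_iff _).2 (AddSubgroup.mem_addSubgroupOf.2 (hE' _ fun v => ?_))
    refine approx_of_natCast_mul (h2 v) hN.ne' (hεlog v) (hU _ z.2 v) ?_
    have := hE _ hNq v
    simpa [nsmul_eq_mul] using this

end Regulator

theorem mainTheorem5 (n : ℕ) (ℓ : ℕ → ℕ) (hℓ : IsDengLi n ℓ)
    (K : Type*) [Field K] [NumberField K] (α : K)
    (hα : α ^ 2 = ((∏ i ∈ Finset.Icc 1 n, ℓ i : ℕ) : K))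
    (hK : IntermediateField.adjoin ℚ {α} = ⊤) :
    Subsingleton (NormalizedRegulator K 2) ∧
    ∀ ε : (𝓞 K)ˣ, Subgroup.closure {-1, ε} = ⊤ →
      (∃ a b : ℤ, Odd a ∧ Odd b ∧ ((ε : 𝓞 K) : K) = 4 * a + b * α) ∧
      ∀ v : PlacesAbove K 2,
        Valued.v (localLog K 2 (unitsDiagonal K 2 ε) v) = Valued.v (4 : v.1.adicCompletion K) := by
  obtain ⟨m, hmdef⟩ : ∃ m : ℤ, m = ((∏ i ∈ Finset.Icc 1 n, ℓ i : ℕ) : ℤ) := ⟨_, rfl⟩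
  have hm : m % 8 = 7 := by
    have := hℓ.prod_Icc_mod_eight
    omega
  have hsq : Squarefree m := hmdef ▸ hℓ.squarefree
  have hαm : α ^ 2 = (m : K) := by
    rw [hα, hmdef, Int.cast_natCast]
  have h2 := valued_two hm hsq hαm hK
  have hres := valued_sub_one_lt hm hsq hαm hK
  have hsub := subsingleton_placesAbove_two hm hsq hαm hK
  have hαv : ∀ v : PlacesAbove K 2, (algebraMap K (v.1.adicCompletion K) α) ^ 2 = m := fun v => by
    rw [← map_pow, hαm, map_intCast]
  have hunit : ∀ ε : (𝓞 K)ˣ, Subgroup.closure {-1, ε} = ⊤ →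
      (∃ a b : ℤ, Odd a ∧ Odd b ∧ ((ε : 𝓞 K) : K) = 4 * a + b * α) ∧
      ∀ v : PlacesAbove K 2,
        Valued.v (localLog K 2 (unitsDiagonal K 2 ε) v) = WithZero.exp (-4) := by
    intro ε hε
    obtain ⟨a, b, ha, hb, hab, hn⟩ := hℓ.exists_fundamentalUnit_eq (hmdef ▸ hαm) hK hε
    refine ⟨⟨a, b, ha, hb, hab⟩, fun v => ?_⟩
    have hεv : (unitsDiagonal K 2 ε : CompletionsAbove K 2) v =
        4 * a + b * algebraMap K (v.1.adicCompletion K) α := by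
      rw [unitsDiagonal_apply, hab]
      simp only [map_add, map_mul, map_intCast, map_ofNat]
    have hp := unitsDiagonal_mem_principalLocalUnits hres ε v
    rw [hεv] at hp
    rw [localLog_apply, hεv]
    exact map_seriesLog_eq (h2 v) (hαv v) ha (hmdef ▸ hn) (Valued.le_exp_neg_one.2 hp)
  refine ⟨?_, fun ε hε => ⟨(hunit ε hε).1, fun v => ?_⟩⟩
  · obtain ⟨f, hf⟩ : ∃ f : Pell.Solution₁ m, Pell.IsFundamental f :=
      hmdef ▸ hℓ.exists_isFundamental
    have hε := closure_eq_top_of_isFundamental (by omega) hsq hαm hK hf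
    exact subsingleton_normalizedRegulator h2 hres
      (fun v x hx => map_seriesLog_le (h2 v) (hres v) hm (hαv v) hx) hε (hunit _ hε).2
  · rw [(hunit ε hε).2 v, show (4 : v.1.adicCompletion K) = 2 ^ 2 by norm_num,
      Valued.map_two_pow (h2 v)]
    norm_num
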